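/- \textbf{Theorem (selection bias of the Hu–Zhang–He ERADE).} Consider a two-treatment clinical trial in which patients arrive sequentially. Let $X_m\in\{1,2\}$ and $Y_m$ be the assignment and the observed response of the $m$-th patient, let $\mathscr F_m=\sigma(X_j,Y_j:j\le m)$, let $N_{m,k}=\#\{j\le m: X_j=k\}$, and let $p_{m+1,k}=\mathsf P(X_{m+1}=k\mid\mathscr F_m)$. Given $\mathscr F_m$ and $X_{m+1}=k$, the response $Y_{m+1}$ has distribution $P_k$, with parameter $\theta_k$ in a parameter space $\Theta_k\subset\mathbb R^{d_k}$. After $m$ patients $\theta=(\theta_1,\theta_2)$ is estimated by $\widehat\theta_m=(\widehat\theta_{m,1},\widehat\theta_{m,2})$, where $\widehat\theta_{m,k}$ is a measurable function of the $N_{m,k}$ responses observed so far on treatment $k$, and for each $k$ one of the following holds: (a) $\{f_k(\cdot\mid t):t\in\Theta_k\}$ is an exponential family, with densities proportional to $e^{\langle\eta(t),T(x)\rangle}$ with respect to a $\sigma$-finite measure $\nu$, where $\Theta_k$ is open, $\eta$ is a homeomorphism of $\Theta_k$ onto its image, $\eta(\Theta_k)$ lies in the interior of the natural parameter space $\{s:\int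 e^{\langle s,T\rangle}d\nu<\infty\}$, and $T$ is not $\nu$-a.e. contained in an affine hyperplane; $P_k$ is the member with parameter $\theta_k$, and $\widehat\theta_{m,k}$ is the maximum likelihood estimator (a maximizer of the likelihood over $\Theta_k$ whenever one exists); (b) $\theta_k\in\Theta_k$ is the mean of an integrable $\mathbb R^{d_k}$-valued function $g_k$ of the response, and $\widehat\theta_{m,k}$ is the sample mean of $g_k$ over the responses on treatment $k$ (for an empty sample, any fixed value). Let $\rho_1$ be a measurable function of the parameter that is continuous on $\Theta_1\times\Theta_2$ with values in $(0,1)$ there (the target allocation proportion of treatment 1), and write $\rho_1=\rho_1(\theta)$ and $\rho_2=1-\rho_1$ for the values at the true parameter. Let $0\le\alpha<1$ and $m_0\ge 1$. The first $m_0$ patients are allocated in an arbitrary way, and for $m\ge m_0$ almost surely $\widehat\theta_m\in\Theta_1\times\Theta_2$ and $$p_{m+1,1}=\begin{cases}\alpha\,\rho_1(\widehat\theta_m), & N_{m,1}/m>\rho_1(\widehat\theta_m),\\ \rho_1(\widehat\theta_m), & N_{m,1}/m=\rho_1(\widehat\theta_m),\\ 1-\alpha\big(1-\rho_1(\widehat\theta_m)\big),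 & N_{m,1}/m<\rho_1(\widehat\theta_m).\end{cases}$$ Suppose that $\mathsf P(\rho_1(\widehat\theta_m)=v)=0$ for every $m\ge m_0$ and every rational $v\in[0,1]$. Suppose an experimenter guesses the assignments optimally: the guess of $X_{m+1}$ is $\mathscr F_m$-measurable and is almost surely a treatment $k$ with $p_{m+1,k}=\max_j p_{m+1,j}$. Let $J_m=1$ if the guess of $X_m$ is correct and $J_m=0$ otherwise, and let $SB_n=\mathsf E\big[\frac1n\sum_{m=1}^nJ_m\big]$. Then $SB=\lim_{n\to\infty}SB_n$ exists and $$SB=\begin{cases}1-2\alpha\rho_1\rho_2, & \text{if } 2\alpha\max(\rho_1,\rho_2)\le 1,\\ \max(\rho_1,\rho_2), & \text{if } 2\alpha\max(\rho_1,\rho_2)\ge 1.\end{cases}$$ -/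

import Mathlib

open MeasureTheory ProbabilityTheory Filter Topology

noncomputable section

/-! Two treatments, indexed by `k : Fin 2` (treatment 1 is `0`, treatment 2 is `1`). Patients are
indexed from `0`: `X m` is the treatment given to the `(m+1)`-st patient and `Y m` is the observed
response of that patient. -/

/-- The range of a `d`-dimensional parameter. -/
abbrev Param (d : ℕ) : Type := EuclideanSpace ℝ (Fin d)

/-- A (regular, minimally represented, identifiable, possibly curved) exponential family on `𝒳`:
with respect to a dominating measure `base`, the density of the member with parameter `θ ∈ Θ`
is proportional to `exp ⟪η θ, T x⟫`. -/
structure ExpFamily (𝒳 : Type*) [MeasurableSpace 𝒳] (d q : ℕ) where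
  base : Measure 𝒳
  sigmaFinite : SigmaFinite base
  /-- sufficient statistic -/
  T : 𝒳 → EuclideanSpace ℝ (Fin q)
  measurable_T : Measurable T
  /-- parameter space -/
  Θ : Set (Param d)
  isOpen_Θ : IsOpen Θ
  /-- natural parameter map -/
  η : Param d → EuclideanSpace ℝ (Fin q)
  /-- `η` is a homeomorphism of `Θ` onto its image -/
  isEmbedding_η : IsEmbedding (Θ.domRestrict η)
  /-- `η` takes values in the interior of the natural parameter space -/
  regular : ∀ θ ∈ Θ,
    η θ ∈ interior {t | Integrable (fun x => Real.exp (inner ℝ t (T x))) base}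
  /-- `T` is not almost everywhere contained in an affine hyperplane -/
  minimal : ∀ t : EuclideanSpace ℝ (Fin q), t ≠ 0 → ∀ c : ℝ,
    ¬ ∀ᵐ x ∂base, inner ℝ t (T x) = c

namespace ExpFamily

variable {𝒳 : Type*} [MeasurableSpace 𝒳] {d q : ℕ}

/-- The density `f(x | θ)` with respect to `base`. -/
def density (F : ExpFamily 𝒳 d q) (θ : Param d) (x : 𝒳) : ℝ :=
  Real.exp (inner ℝ (F.η θ) (F.T x)) / ∫ y, Real.exp (inner ℝ (F.η θ) (F.T y)) ∂F.base

/-- The response distribution with parameter `θ`. -/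
def law (F : ExpFamily 𝒳 d q) (θ : Param d) : Measure 𝒳 :=
  F.base.withDensity (fun x => ENNReal.ofReal (F.density θ x))

/-- The likelihood of a sample of size `n`. -/
def likelihood (F : ExpFamily 𝒳 d q) {n : ℕ} (x : Fin n → 𝒳) (θ : Param d) : ℝ :=
  ∏ i, F.density θ (x i)

/-- `est` is the maximum likelihood estimator: for each sample for which the likelihood attains
its maximum over the parameter space, `est` is a maximizer. -/
def IsMLE (F : ExpFamily 𝒳 d q) (est : (n : ℕ) → (Fin n → 𝒳) → Param d) : Prop :=
  ∀ (n : ℕ) (x : Fin n → 𝒳), (∃ θ ∈ F.Θ, IsMaxOn (F.likelihood x) F.Θ θ) →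
    est n x ∈ F.Θ ∧ IsMaxOn (F.likelihood x) F.Θ (est n x)

end ExpFamily

/-- `est` is the sample mean of the (vector-valued) response `g`. -/
def IsSampleMean {𝒳 : Type*} {d : ℕ} (g : 𝒳 → Param d)
    (est : (n : ℕ) → (Fin n → 𝒳) → Param d) : Prop :=
  ∀ (n : ℕ) (x : Fin n → 𝒳), 0 < n → est n x = (n : ℝ)⁻¹ • ∑ i, g (x i)

/-- The statistical model of one treatment, with parameter space `Θ`, true parameter `θ`, response
distribution `P` and estimator `est`: either `P` belongs to an exponential family and `est` is the
maximum likelihood estimator, or `θ` is the mean response and `est` is the sample mean. -/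
def IsResponseModel {𝒳 : Type*} [MeasurableSpace 𝒳] {d : ℕ} (Θ : Set (Param d)) (θ : Param d)
    (P : Measure 𝒳) (est : (n : ℕ) → (Fin n → 𝒳) → Param d) : Prop :=
  (∃ (q : ℕ) (F : ExpFamily 𝒳 d q), F.Θ = Θ ∧ P = F.law θ ∧ F.IsMLE est) ∨
  (IsProbabilityMeasure P ∧ ∃ g : 𝒳 → Param d, Measurable g ∧ Integrable g P ∧
    θ = ∫ x, g x ∂P ∧ IsSampleMean g est)

section Design

variable {Ω 𝒳 : Type*}

/-- `N_{m,k}`: the number of the first `m` patients who are assigned to treatment `k`. -/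
def numAssigned (X : ℕ → Ω → Fin 2) (m : ℕ) (k : Fin 2) (ω : Ω) : ℕ :=
  Nat.count (fun j => X j ω = k) m

/-- The responses observed on treatment `k` among the first `m` patients, in order of arrival. -/
def observedSample (X : ℕ → Ω → Fin 2) (Y : ℕ → Ω → 𝒳) (m : ℕ) (k : Fin 2) (ω : Ω) :
    Fin (numAssigned X m k ω) → 𝒳 :=
  fun i => Y (Nat.nth (fun j => X j ω = k) i) ω

/-- `θ̂_m = (θ̂_{m,1}, θ̂_{m,2})`: each component is computed from the responses observed on its
treatment among the first `m` patients. -/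
def estimate {d : Fin 2 → ℕ} (est : (k : Fin 2) → (n : ℕ) → (Fin n → 𝒳) → Param (d k))
    (X : ℕ → Ω → Fin 2) (Y : ℕ → Ω → 𝒳) (m : ℕ) (ω : Ω) : (k : Fin 2) → Param (d k) :=
  fun k => est k (numAssigned X m k ω) (observedSample X Y m k ω)

/-- The sigma-field generated by the assignments and responses of the first `m` patients. -/
abbrev history [MeasurableSpace 𝒳] (X : ℕ → Ω → Fin 2) (Y : ℕ → Ω → 𝒳) (m : ℕ) :
    MeasurableSpace Ω :=
  MeasurableSpace.comap (fun ω (j : Fin m) => (X j ω, Y j ω)) inferInstance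

/-- `p_{m+1,k}`: the conditional probability, given the history of the first `m` patients, that
the next patient is assigned to treatment `k`. -/
def allocProb [MeasurableSpace 𝒳] [MeasurableSpace Ω] (μ : Measure Ω) (X : ℕ → Ω → Fin 2)
    (Y : ℕ → Ω → 𝒳) (m : ℕ) (k : Fin 2) : Ω → ℝ :=
  μ[({ω | X m ω = k} : Set Ω).indicator (fun _ => (1 : ℝ)) | history X Y m]

/-- The allocation function of Hu, Zhang and He: the probability of treatment 1 when its current
proportion is `x` and its estimated target proportion is `r`. -/
def eradeProb (α r x : ℝ) : ℝ :=
  if r < x then α * r else if x = r then r else 1 - α * (1 - r)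

/-- `(X, Y)` is a two-treatment trial, with response distributions `P 0`, `P 1`, run by the
procedure of Hu, Zhang and He with parameter `α`, target function `ρ₁` and estimator `est`.
The first `m₀` assignments are arbitrary. -/
structure IsERADE [MeasurableSpace 𝒳] [MeasurableSpace Ω] (μ : Measure Ω) {d : Fin 2 → ℕ}
    (α : ℝ) (ρ₁ : ((k : Fin 2) → Param (d k)) → ℝ)
    (est : (k : Fin 2) → (n : ℕ) → (Fin n → 𝒳) → Param (d k)) (P : Fin 2 → Measure 𝒳)
    (m₀ : ℕ) (X : ℕ → Ω → Fin 2) (Y : ℕ → Ω → 𝒳) : Prop where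
  measurable_X : ∀ m, Measurable (X m)
  measurable_Y : ∀ m, Measurable (Y m)
  /-- given the history and the assignment to `k`, the response has distribution `P k` -/
  response : ∀ (m : ℕ) (k : Fin 2) (B : Set 𝒳), MeasurableSet B →
    μ[({ω | X m ω = k ∧ Y m ω ∈ B} : Set Ω).indicator (fun _ => (1 : ℝ)) | history X Y m]
      =ᵐ[μ] fun ω => (P k).real B * allocProb μ X Y m k ω
  /-- the allocation rule -/
  allocation : ∀ m, m₀ ≤ m → allocProb μ X Y m 0 =ᵐ[μ] fun ω =>
    eradeProb α (ρ₁ (estimate est X Y m ω)) ((numAssigned X m 0 ω : ℝ) / (m : ℝ))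

/-- `G` guesses optimally: `G m`, the guess of the next assignment after `m` patients, depends on
the history only and is a treatment with the largest allocation probability. -/
def IsOptimalGuess [MeasurableSpace 𝒳] [MeasurableSpace Ω] (μ : Measure Ω) (X : ℕ → Ω → Fin 2)
    (Y : ℕ → Ω → 𝒳) (G : ℕ → Ω → Fin 2) : Prop :=
  ∀ m, Measurable[history X Y m] (G m) ∧
    ∀ᵐ ω ∂μ, ∀ k, allocProb μ X Y m k ω ≤ allocProb μ X Y m (G m ω) ω

/-- `SB_n`: the expected proportion of correct guesses among the first `n` assignments. -/
def selectionBias [MeasurableSpace Ω] (μ : Measure Ω) (X G : ℕ → Ω → Fin 2) (n : ℕ) : ℝ :=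
  ∫ ω, (1 / (n : ℝ)) * ∑ m ∈ Finset.range n, (if G m ω = X m ω then (1 : ℝ) else 0) ∂μ

end Design

end

/-! Both parts of the limit come from one computation. Write `r_m` for the estimated target after
`m` patients, `ρ` for the true one and `p_m` for the conditional probability of treatment 1. The
assumption on rational values excludes ties, so `p_m` is `α r_m` or `1 - α (1 - r_m)`, and once
`r_m` is close to `ρ` it takes essentially two values. Hence the largest allocation probability,
which is the conditional probability of a correct guess, is nearly an affine function of `p_m`
(`abs_max_eradeProb_sub_le`). Averaging over the patients, the limit is determined by the limit of
the average of `E p_m`, that is, of the expected allocation proportion.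

*The proportion converges to `ρ`.* With `D_n = N_{n,1} - n ρ`, the drift `D_n (p_n - ρ)` is at most
`n |r_n - ρ|` (`eradeProb_drift_le`), so `E D_n²` grows by at most `1 + 2 n E|r_n - ρ|` per
patient and is `o(n²)` as soon as `r_n → ρ` almost surely.

*The estimated target converges to `ρ`.* By Lévy's conditional Borel–Cantelli lemma both treatments
are assigned infinitely often (`IsERADE.ae_tendsto_numAssigned`). The responses on one treatment,
completed by an independent sample on a product space, are pairwise independent and identically
distributed, so that Etemadi's strong law applies to them (`ae_tendsto_average_nthResponse`). This
is all that the sample mean needs. For the maximum likelihood estimator, the likelihood of a sample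
of size `n` with mean statistic `c` is the `-n`-th power of the convex function
`s ↦ ∫ exp ⟪s, T - c⟫`. At the limiting value of `c` this function has a strict minimum at the true
parameter, and by convexity the minimum is stable under small changes of `c`
(`ExpFamily.tendsto_mle`). -/

/-! ### Exponential families: consistency of the maximum likelihood estimator -/

namespace ExpFamily

variable {𝒳 : Type*} [MeasurableSpace 𝒳] {d q : ℕ}

/-- The natural parameter space, on which the partition function is finite. -/
def natParam (F : ExpFamily 𝒳 d q) : Set (EuclideanSpace ℝ (Fin q)) :=
  {t | Integrable (fun x => Real.exp (inner ℝ t (F.T x))) F.base}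

/-- The partition function of the family recentred at `c`, `s ↦ ∫ exp ⟪s, T - c⟫`. For `c` the
sample mean of `T`, it is the likelihood raised to the power `-1/n`. -/
noncomputable def centredPartition (F : ExpFamily 𝒳 d q) (c s : EuclideanSpace ℝ (Fin q)) : ℝ :=
  ∫ x, Real.exp (inner ℝ s (F.T x - c)) ∂F.base

lemma integrable_exp_centred (F : ExpFamily 𝒳 d q) {s : EuclideanSpace ℝ (Fin q)}
    (hs : s ∈ F.natParam) (c : EuclideanSpace ℝ (Fin q)) :
    Integrable (fun x => Real.exp (inner ℝ s (F.T x - c))) F.base := by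
  have h : Integrable (fun x => Real.exp (inner ℝ s (F.T x))) F.base := hs
  convert h.mul_const (Real.exp (-inner ℝ s c)) using 2 with x
  rw [inner_sub_right, sub_eq_add_neg, Real.exp_add]

lemma exp_combo_le (F : ExpFamily 𝒳 d q) (c s t : EuclideanSpace ℝ (Fin q)) {a b : ℝ}
    (ha : 0 ≤ a) (hb : 0 ≤ b) (hab : a + b = 1) (x : 𝒳) :
    Real.exp (inner ℝ (a • s + b • t) (F.T x - c)) ≤
      a * Real.exp (inner ℝ s (F.T x - c)) + b * Real.exp (inner ℝ t (F.T x - c)) := by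
  have := convexOn_exp.2 (Set.mem_univ (inner ℝ s (F.T x - c)))
    (Set.mem_univ (inner ℝ t (F.T x - c))) ha hb hab
  simpa [inner_add_left, inner_smul_left] using this

lemma measurable_exp_inner (F : ExpFamily 𝒳 d q) (c s : EuclideanSpace ℝ (Fin q)) :
    Measurable (fun x => Real.exp (inner ℝ s (F.T x - c))) :=
  Real.measurable_exp.comp (measurable_const.inner (F.measurable_T.sub_const c))

lemma convex_natParam (F : ExpFamily 𝒳 d q) : Convex ℝ F.natParam := by
  intro s hs t ht a b ha hb hab
  have h1 := (F.integrable_exp_centred hs 0).const_mul a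
  have h2 := (F.integrable_exp_centred ht 0).const_mul b
  have h3 : Integrable (fun x => Real.exp (inner ℝ (a • s + b • t) (F.T x - 0))) F.base := by
    refine (h1.add h2).mono' (F.measurable_exp_inner _ _).aestronglyMeasurable ?_
    refine Eventually.of_forall fun x => ?_
    rw [Real.norm_eq_abs, abs_of_pos (Real.exp_pos _)]
    exact F.exp_combo_le 0 s t ha hb hab x
  simpa [natParam] using h3

lemma convexOn_centredPartition (F : ExpFamily 𝒳 d q) (c : EuclideanSpace ℝ (Fin q)) :
    ConvexOn ℝ F.natParam (F.centredPartition c) := by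
  refine ⟨F.convex_natParam, fun s hs t ht a b ha hb hab => ?_⟩
  have h1 := (F.integrable_exp_centred hs c).const_mul a
  have h2 := (F.integrable_exp_centred ht c).const_mul b
  have h3 := F.integrable_exp_centred (F.convex_natParam hs ht ha hb hab) c
  calc F.centredPartition c (a • s + b • t)
      ≤ ∫ x, (a * Real.exp (inner ℝ s (F.T x - c)) + b * Real.exp (inner ℝ t (F.T x - c))) ∂F.base :=
        integral_mono h3 (h1.add h2) fun x => F.exp_combo_le c s t ha hb hab x
    _ = _ := by
        rw [integral_add h1 h2, integral_const_mul, integral_const_mul]; rfl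

lemma continuousOn_centredPartition (F : ExpFamily 𝒳 d q) (c : EuclideanSpace ℝ (Fin q)) :
    ContinuousOn (F.centredPartition c) (interior F.natParam) :=
  (F.convexOn_centredPartition c).continuousOn_interior

lemma centredPartition_pos (F : ExpFamily 𝒳 d q) (hF : F.base ≠ 0)
    {s : EuclideanSpace ℝ (Fin q)} (hs : s ∈ F.natParam) (c : EuclideanSpace ℝ (Fin q)) :
    0 < F.centredPartition c s := by
  have : NeZero F.base := ⟨hF⟩
  exact integral_exp_pos (F.integrable_exp_centred hs c)

/-- Change of the centre. -/
lemma centredPartition_eq_mul (F : ExpFamily 𝒳 d q) (c c' s : EuclideanSpace ℝ (Fin q)) :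
    F.centredPartition c' s = F.centredPartition c s * Real.exp (inner ℝ s (c - c')) := by
  rw [centredPartition, centredPartition, ← integral_mul_const]
  refine integral_congr_ae (Eventually.of_forall fun x => ?_)
  simp only
  rw [← Real.exp_add, ← inner_add_right]
  congr 2; abel

/-- In the interior of the natural parameter space the statistic is integrable against the
unnormalised density: each coordinate of `T` is dominated by the sum of two exponentials. -/
lemma integrable_exp_smul_T (F : ExpFamily 𝒳 d q) {s : EuclideanSpace ℝ (Fin q)}
    (hs : s ∈ interior F.natParam) :
    Integrable (fun x => Real.exp (inner ℝ s (F.T x)) • F.T x) F.base := by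
  obtain ⟨ε, hε, hball⟩ := Metric.isOpen_iff.1 isOpen_interior s hs
  have hmem : ∀ i : Fin q, ∀ r : ℝ, |r| < ε →
      Integrable (fun x => Real.exp (inner ℝ (s + r • EuclideanSpace.single i (1:ℝ)) (F.T x)))
        F.base := by
    intro i r hr
    have : s + r • EuclideanSpace.single i (1:ℝ) ∈ F.natParam :=
      interior_subset (hball (by simp [dist_eq_norm, norm_smul, hr]))
    exact this
  have he : 0 < ε / 2 := by positivity
  have hlt : |ε / 2| < ε := by rw [abs_of_pos he]; linarith
  have hlt' : |-(ε / 2)| < ε := by rw [abs_neg]; exact hlt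
  have hdom : Integrable (fun x => ∑ i : Fin q, (ε / 2)⁻¹ *
      (Real.exp (inner ℝ (s + (ε / 2) • EuclideanSpace.single i (1:ℝ)) (F.T x)) +
       Real.exp (inner ℝ (s + (-(ε / 2)) • EuclideanSpace.single i (1:ℝ)) (F.T x)))) F.base :=
    integrable_finsetSum _ fun i _ => ((hmem i _ hlt).add (hmem i _ hlt')).const_mul _
  refine hdom.mono' ?_ (Eventually.of_forall fun x => ?_)
  · have := F.measurable_exp_inner 0 s
    simp only [sub_zero] at this
    exact (this.smul F.measurable_T).aestronglyMeasurable
  · have hnorm : ‖F.T x‖ ≤ ∑ i, |F.T x i| := by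
      have h : F.T x = ∑ i, (F.T x i) • EuclideanSpace.single i (1:ℝ) := by
        ext j; simp [Finset.sum_apply, Pi.single_apply]
      calc ‖F.T x‖ = ‖∑ i, (F.T x i) • EuclideanSpace.single i (1:ℝ)‖ := by rw [← h]
        _ ≤ ∑ i, ‖(F.T x i) • EuclideanSpace.single i (1:ℝ)‖ := norm_sum_le _ _
        _ = _ := by simp [norm_smul]
    rw [norm_smul, Real.norm_eq_abs, abs_of_pos (Real.exp_pos _)]
    calc _ ≤ Real.exp (inner ℝ s (F.T x)) * ∑ i, |F.T x i| := by gcongr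
      _ = ∑ i, Real.exp (inner ℝ s (F.T x)) * |F.T x i| := Finset.mul_sum _ _ _
      _ ≤ _ := Finset.sum_le_sum fun i _ => ?_
    simp only [inner_add_left, inner_smul_left, EuclideanSpace.inner_single_left, Real.exp_add]
    simp only [map_one, one_mul, conj_trivial]
    set y := F.T x i
    have key : |y| ≤ (ε / 2)⁻¹ * (Real.exp (ε / 2 * y) + Real.exp (-(ε / 2) * y)) := by
      rw [inv_mul_eq_div, le_div_iff₀ he]
      have h1 := Real.add_one_le_exp (ε / 2 * y)
      have h2 := Real.add_one_le_exp (-(ε / 2) * y)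
      have h3 := Real.exp_pos (ε / 2 * y)
      have h4 := Real.exp_pos (-(ε / 2) * y)
      rcases abs_cases y with ⟨h, _⟩ | ⟨h, _⟩ <;> rw [h] <;> nlinarith
    have := mul_le_mul_of_nonneg_left key (Real.exp_pos (inner ℝ s (F.T x))).le
    linarith

lemma integral_exp_eq (F : ExpFamily 𝒳 d q) (s : EuclideanSpace ℝ (Fin q)) :
    ∫ x, Real.exp (inner ℝ s (F.T x)) ∂F.base = F.centredPartition 0 s := by
  simp [centredPartition]

lemma η_mem_interior (F : ExpFamily 𝒳 d q) {t : Param d} (ht : t ∈ F.Θ) :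
    F.η t ∈ interior F.natParam := F.regular t ht

lemma measurable_density (F : ExpFamily 𝒳 d q) (t : Param d) : Measurable (F.density t) := by
  have := F.measurable_exp_inner 0 (F.η t)
  simp only [sub_zero] at this
  exact this.div_const _

lemma density_nonneg (F : ExpFamily 𝒳 d q) (t : Param d) (x : 𝒳) : 0 ≤ F.density t x :=
  div_nonneg (Real.exp_pos _).le (integral_nonneg fun _ => (Real.exp_pos _).le)

lemma isProbabilityMeasure_law (F : ExpFamily 𝒳 d q) (hF : F.base ≠ 0) {t : Param d}
    (ht : t ∈ F.Θ) : IsProbabilityMeasure (F.law t) := by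
  have hs := interior_subset (F.η_mem_interior ht)
  have hpos := F.centredPartition_pos hF hs 0
  refine ⟨?_⟩
  rw [law, withDensity_apply _ MeasurableSet.univ, Measure.restrict_univ,
    ← ofReal_integral_eq_lintegral_ofReal]
  · simp only [density]
    rw [integral_div, integral_exp_eq, div_self hpos.ne', ENNReal.ofReal_one]
  · have := (F.integrable_exp_centred hs 0).div_const (F.centredPartition 0 (F.η t))
    refine this.congr (Eventually.of_forall fun x => ?_)
    simp [density, centredPartition]
  · exact Eventually.of_forall fun x => F.density_nonneg t x

/-- The law in the form that the lemmas on densities with values in `ℝ≥0` expect. -/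
lemma law_eq (F : ExpFamily 𝒳 d q) (t : Param d) :
    F.law t = F.base.withDensity (fun x => ((F.density t x).toNNReal : ENNReal)) := rfl

lemma integrable_T (F : ExpFamily 𝒳 d q) {t : Param d} (ht : t ∈ F.Θ) :
    Integrable F.T (F.law t) := by
  rw [law_eq, integrable_withDensity_iff_integrable_smul
    (F.measurable_density t).real_toNNReal]
  have h := (F.integrable_exp_smul_T (F.η_mem_interior ht)).smul (F.centredPartition 0 (F.η t))⁻¹
  refine h.congr (Eventually.of_forall fun x => ?_)
  simp only [Pi.smul_apply, NNReal.smul_def, Real.coe_toNNReal _ (F.density_nonneg t x), smul_smul]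
  rw [density, integral_exp_eq, inv_mul_eq_div]

lemma integral_T (F : ExpFamily 𝒳 d q) (t : Param d) :
    ∫ x, F.T x ∂F.law t = (F.centredPartition 0 (F.η t))⁻¹ •
      ∫ x, Real.exp (inner ℝ (F.η t) (F.T x)) • F.T x ∂F.base := by
  rw [law_eq, integral_withDensity_eq_integral_smul (F.measurable_density t).real_toNNReal,
    ← integral_smul]
  refine integral_congr_ae (Eventually.of_forall fun x => ?_)
  simp only [NNReal.smul_def, Real.coe_toNNReal _ (F.density_nonneg t x), smul_smul]
  rw [density, integral_exp_eq, inv_mul_eq_div]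

/-- Gibbs' inequality: centred at the mean of `T` under the member with parameter `t`, the partition
function has a strict minimum at `η t`. -/
lemma centredPartition_lt (F : ExpFamily 𝒳 d q) (hF : F.base ≠ 0) {t : Param d} (ht : t ∈ F.Θ)
    {s : EuclideanSpace ℝ (Fin q)} (hs : s ∈ F.natParam) (hne : s ≠ F.η t) :
    F.centredPartition (∫ x, F.T x ∂F.law t) (F.η t) <
      F.centredPartition (∫ x, F.T x ∂F.law t) s := by
  set c := ∫ x, F.T x ∂F.law t with hc
  have ht' := F.η_mem_interior ht
  have ht0 := interior_subset ht'
  set e := F.η t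
  have hpos := F.centredPartition_pos hF ht0 0
  have hTint := F.integrable_exp_smul_T ht'
  have hint0 := F.integrable_exp_centred ht0 0
  simp only [sub_zero] at hint0
  -- the centred statistic has mean zero under the member `t`
  have hmean0 : ∫ x, Real.exp (inner ℝ e (F.T x)) • (F.T x - c) ∂F.base = 0 := by
    simp only [smul_sub]
    rw [integral_sub hTint (hint0.smul_const c), integral_smul_const, integral_exp_eq, hc,
      integral_T, smul_smul, mul_inv_cancel₀ hpos.ne', one_smul, sub_self]
  have hint1 : Integrable (fun x => Real.exp (inner ℝ e (F.T x)) • (F.T x - c)) F.base := by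
    simp only [smul_sub]
    exact hTint.sub (hint0.smul_const c)
  have hexp : ∀ x, Real.exp (inner ℝ e (F.T x - c)) =
      Real.exp (-inner ℝ e c) * Real.exp (inner ℝ e (F.T x)) := fun x => by
    rw [← Real.exp_add, inner_sub_right]; congr 1; ring
  have hlin_eq : ∀ x, Real.exp (inner ℝ e (F.T x - c)) * inner ℝ (s - e) (F.T x - c) =
      Real.exp (-inner ℝ e c) *
        inner ℝ (s - e) (Real.exp (inner ℝ e (F.T x)) • (F.T x - c)) := fun x => by
    rw [hexp, inner_smul_right]; ring
  have hlin : Integrable (fun x => Real.exp (inner ℝ e (F.T x - c)) *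
      inner ℝ (s - e) (F.T x - c)) F.base := by
    simp only [hlin_eq]
    exact (hint1.const_inner _).const_mul _
  have hlin0 : ∫ x, Real.exp (inner ℝ e (F.T x - c)) * inner ℝ (s - e) (F.T x - c) ∂F.base = 0 := by
    simp only [hlin_eq]
    rw [integral_const_mul, integral_inner hint1, hmean0, inner_zero_right, mul_zero]
  have he := F.integrable_exp_centred ht0 c
  have hse := F.integrable_exp_centred hs c
  have hsplit : ∀ x, Real.exp (inner ℝ s (F.T x - c)) = Real.exp (inner ℝ e (F.T x - c)) *
      Real.exp (inner ℝ (s - e) (F.T x - c)) := fun x => by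
    rw [← Real.exp_add, ← inner_add_left]; congr 2; abel
  have hsum : Integrable (fun x => Real.exp (inner ℝ e (F.T x - c)) +
      Real.exp (inner ℝ e (F.T x - c)) * inner ℝ (s - e) (F.T x - c)) F.base := he.add hlin
  have hgap_nonneg : ∀ x, 0 ≤ Real.exp (inner ℝ s (F.T x - c)) -
      (Real.exp (inner ℝ e (F.T x - c)) +
        Real.exp (inner ℝ e (F.T x - c)) * inner ℝ (s - e) (F.T x - c)) := fun x => by
    rw [hsplit]
    have := mul_le_mul_of_nonneg_left (Real.add_one_le_exp (inner ℝ (s - e) (F.T x - c)))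
      (Real.exp_pos (inner ℝ e (F.T x - c))).le
    linarith
  have hgap : 0 < ∫ x, (Real.exp (inner ℝ s (F.T x - c)) -
      (Real.exp (inner ℝ e (F.T x - c)) +
        Real.exp (inner ℝ e (F.T x - c)) * inner ℝ (s - e) (F.T x - c))) ∂F.base := by
    refine lt_of_le_of_ne (integral_nonneg hgap_nonneg) fun h0 => ?_
    have hz := (integral_eq_zero_iff_of_nonneg hgap_nonneg (hse.sub hsum)).1 h0.symm
    refine F.minimal (s - e) (sub_ne_zero.2 hne) (inner ℝ (s - e) c) ?_
    filter_upwards [hz] with x hx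
    by_contra hcon
    have hne0 : inner ℝ (s - e) (F.T x - c) ≠ 0 := by
      rw [inner_sub_right]; exact sub_ne_zero.2 hcon
    have h1 := mul_lt_mul_of_pos_left (Real.add_one_lt_exp hne0)
      (Real.exp_pos (inner ℝ e (F.T x - c)))
    simp only [Pi.zero_apply] at hx
    rw [hsplit] at hx
    linarith
  rw [integral_sub hse hsum, integral_add he hlin, hlin0, add_zero] at hgap
  exact sub_pos.1 hgap

/-- Uniqueness of the minimum persists when the centre moves slightly: compactness gives a gap on a
sphere about `η t`, and convexity carries it to the outside of the sphere. -/
lemma exists_centredPartition_lt (F : ExpFamily 𝒳 d q) (hF : F.base ≠ 0) {t : Param d}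
    (ht : t ∈ F.Θ) {r : ℝ} (hr : 0 < r)
    (hball : Metric.closedBall (F.η t) r ⊆ interior F.natParam) :
    ∃ δ > 0, ∀ c, ‖(∫ x, F.T x ∂F.law t) - c‖ < δ → ∀ s ∈ F.natParam, r ≤ ‖s - F.η t‖ →
      F.centredPartition c (F.η t) < F.centredPartition c s := by
  set m := ∫ x, F.T x ∂F.law t with hm
  have ht0 := interior_subset (F.η_mem_interior ht)
  set e := F.η t with he
  have hfe : 0 < F.centredPartition m e := F.centredPartition_pos hF ht0 m
  have hsub : Metric.sphere e r ⊆ interior F.natParam := Metric.sphere_subset_closedBall.trans hball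
  obtain ⟨M, hM, hMle⟩ : ∃ M, F.centredPartition m e < M ∧
      ∀ s ∈ Metric.sphere e r, M ≤ F.centredPartition m s := by
    rcases (Metric.sphere e r).eq_empty_or_nonempty with h0 | h0
    · exact ⟨F.centredPartition m e + 1, by linarith, by simp [h0]⟩
    · obtain ⟨s, hs, hmin⟩ := (isCompact_sphere e r).exists_isMinOn h0
        ((F.continuousOn_centredPartition m).mono hsub)
      refine ⟨_, F.centredPartition_lt hF ht (interior_subset (hsub hs)) ?_, hmin⟩
      rintro rfl
      rw [mem_sphere_iff_norm, he, sub_self, norm_zero] at hs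
      exact hr.ne hs
  have hMpos : 0 < M := hfe.trans hM
  have hlog : 0 < Real.log (M / F.centredPartition m e) := Real.log_pos ((one_lt_div hfe).2 hM)
  refine ⟨Real.log (M / F.centredPartition m e) / r, by positivity, fun c hc => ?_⟩
  have hsphere : ∀ s ∈ Metric.sphere e r, F.centredPartition c e < F.centredPartition c s := by
    intro s hs
    rw [F.centredPartition_eq_mul m c e, F.centredPartition_eq_mul m c s]
    have hnorm : ‖s - e‖ = r := by simpa [dist_eq_norm] using hs
    have h1 : -Real.log (M / F.centredPartition m e) < inner ℝ (s - e) (m - c) := by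
      have := (abs_le.1 (abs_real_inner_le_norm (s - e) (m - c))).1
      rw [hnorm] at this
      rw [lt_div_iff₀ hr] at hc
      linarith
    have h2 : F.centredPartition m e < M * Real.exp (inner ℝ (s - e) (m - c)) := by
      have := Real.exp_lt_exp.2 h1
      rw [Real.exp_neg, Real.exp_log (by positivity), inv_div, div_lt_iff₀ hMpos] at this
      linarith
    have h3 : F.centredPartition m e < F.centredPartition m s *
        Real.exp (inner ℝ (s - e) (m - c)) :=
      h2.trans_le (mul_le_mul_of_nonneg_right (hMle s hs) (Real.exp_pos _).le)
    have h4 : Real.exp (inner ℝ s (m - c)) =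
        Real.exp (inner ℝ (s - e) (m - c)) * Real.exp (inner ℝ e (m - c)) := by
      rw [← Real.exp_add, ← inner_add_left, sub_add_cancel]
    rw [h4, ← mul_assoc]
    exact mul_lt_mul_of_pos_right h3 (Real.exp_pos _)
  intro s hs hsr
  have hR : 0 < ‖s - e‖ := hr.trans_le hsr
  set a := r / ‖s - e‖
  have ha0 : 0 < a := by positivity
  have ha1 : a ≤ 1 := (div_le_one hR).2 hsr
  have hmem : (1 - a) • e + a • s ∈ Metric.sphere e r := by
    have : (1 - a) • e + a • s - e = a • (s - e) := by module
    rw [mem_sphere_iff_norm, this, norm_smul, Real.norm_eq_abs, abs_of_pos ha0,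
      div_mul_cancel₀ _ hR.ne']
  have h1 := hsphere _ hmem
  have h2 := (F.convexOn_centredPartition c).2 ht0 hs (sub_nonneg.2 ha1) ha0.le (by ring)
  simp only [smul_eq_mul] at h2
  nlinarith

lemma likelihood_eq (F : ExpFamily 𝒳 d q) {n : ℕ} (hn : 0 < n) (x : Fin n → 𝒳) (t : Param d) :
    F.likelihood x t = ((F.centredPartition ((n : ℝ)⁻¹ • ∑ i, F.T (x i)) (F.η t))⁻¹) ^ n := by
  have hn' : (n : ℝ) ≠ 0 := by exact_mod_cast hn.ne'
  simp only [likelihood, density]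
  rw [Finset.prod_div_distrib, ← Real.exp_sum, Finset.prod_const, Finset.card_univ,
    Fintype.card_fin, integral_exp_eq,
    F.centredPartition_eq_mul 0 ((n : ℝ)⁻¹ • ∑ i, F.T (x i)), mul_inv, mul_pow, ← Real.exp_neg,
    ← Real.exp_nat_mul, zero_sub, inner_neg_right, neg_neg, inner_smul_right, inner_sum,
    mul_inv_cancel_left₀ hn', div_eq_mul_inv, inv_pow, mul_comm]

lemma likelihood_lt_iff (F : ExpFamily 𝒳 d q) (hF : F.base ≠ 0) {n : ℕ} (hn : 0 < n)
    (x : Fin n → 𝒳) {t t' : Param d} (ht : t ∈ F.Θ) (ht' : t' ∈ F.Θ) :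
    F.likelihood x t' < F.likelihood x t ↔
      F.centredPartition ((n : ℝ)⁻¹ • ∑ i, F.T (x i)) (F.η t) <
        F.centredPartition ((n : ℝ)⁻¹ • ∑ i, F.T (x i)) (F.η t') := by
  have h1 := F.centredPartition_pos hF (interior_subset (F.η_mem_interior ht))
    ((n : ℝ)⁻¹ • ∑ i, F.T (x i))
  have h2 := F.centredPartition_pos hF (interior_subset (F.η_mem_interior ht'))
    ((n : ℝ)⁻¹ • ∑ i, F.T (x i))
  rw [F.likelihood_eq hn, F.likelihood_eq hn,
    pow_lt_pow_iff_left₀ (inv_pos.2 h2).le (inv_pos.2 h1).le hn.ne', inv_lt_inv₀ h2 h1]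

lemma continuousOn_η (F : ExpFamily 𝒳 d q) : ContinuousOn F.η F.Θ :=
  continuousOn_iff_continuous_domRestrict.2 F.isEmbedding_η.continuous

lemma continuousOn_likelihood (F : ExpFamily 𝒳 d q) (hF : F.base ≠ 0) {n : ℕ} (hn : 0 < n)
    (x : Fin n → 𝒳) : ContinuousOn (F.likelihood x) F.Θ := by
  have h1 : ContinuousOn (fun t => F.centredPartition ((n : ℝ)⁻¹ • ∑ i, F.T (x i)) (F.η t)) F.Θ :=
    (F.continuousOn_centredPartition _).comp F.continuousOn_η fun t ht => F.η_mem_interior ht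
  have h2 := (h1.inv₀ fun t ht =>
    (F.centredPartition_pos hF (interior_subset (F.η_mem_interior ht)) _).ne').pow n
  exact h2.congr fun t _ => F.likelihood_eq hn x t

/-- If the sample means of the sufficient statistic converge to its expectation, the maximum
likelihood estimates converge to the true parameter. In particular a maximizer of the likelihood
eventually exists: outside a compact neighbourhood of the true parameter the likelihood is smaller
than at the true parameter. -/
theorem tendsto_mle (F : ExpFamily 𝒳 d q) (hF : F.base ≠ 0) {t : Param d} (ht : t ∈ F.Θ)
    {est : (n : ℕ) → (Fin n → 𝒳) → Param d} (hest : F.IsMLE est) (w : ℕ → 𝒳)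
    (hw : Tendsto (fun n : ℕ => (n : ℝ)⁻¹ • ∑ i ∈ Finset.range n, F.T (w i)) atTop
      (𝓝 (∫ x, F.T x ∂F.law t))) :
    Tendsto (fun n => est n (fun i => w i)) atTop (𝓝 t) := by
  rw [tendsto_def]
  intro U hU
  obtain ⟨K, hK, hKU, hKc⟩ := local_compact_nhds (inter_mem hU (F.isOpen_Θ.mem_nhds ht))
  obtain ⟨r₁, hr₁, hball⟩ := Metric.isOpen_iff.1 isOpen_interior _ (F.η_mem_interior ht)
  obtain ⟨r₂, hr₂, hloc⟩ : ∃ r > 0, ∀ t' ∈ F.Θ, ‖F.η t' - F.η t‖ < r → t' ∈ K := by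
    have h1 : (Subtype.val ⁻¹' K : Set F.Θ) ∈ 𝓝 (⟨t, ht⟩ : F.Θ) :=
      continuous_subtype_val.continuousAt.preimage_mem_nhds hK
    rw [F.isEmbedding_η.nhds_eq_comap, mem_comap] at h1
    obtain ⟨V, hV, hVK⟩ := h1
    obtain ⟨r, hr, hrV⟩ := Metric.mem_nhds_iff.1 hV
    refine ⟨r, hr, fun t' ht' hlt => ?_⟩
    have : (⟨t', ht'⟩ : F.Θ) ∈ F.Θ.domRestrict F.η ⁻¹' V := hrV (by
      rw [Metric.mem_ball, dist_eq_norm]; exact hlt)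
    exact hVK this
  obtain ⟨δ, hδ, hlt⟩ := F.exists_centredPartition_lt hF ht (r := min (r₁ / 2) r₂) (by positivity)
    ((Metric.closedBall_subset_ball ((min_le_left _ _).trans_lt (by linarith))).trans hball)
  filter_upwards [Metric.tendsto_nhds.1 hw δ hδ, eventually_gt_atTop 0] with n hn hn0
  rw [dist_comm, dist_eq_norm, ← Fin.sum_univ_eq_sum_range (fun i => F.T (w i))] at hn
  set x : Fin n → 𝒳 := fun i => w i
  have hout : ∀ t' ∈ F.Θ, t' ∉ K → F.likelihood x t' < F.likelihood x t := fun t' ht' hK' => by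
    rw [F.likelihood_lt_iff hF hn0 x ht ht']
    refine hlt _ hn _ (interior_subset (F.η_mem_interior ht')) ?_
    exact (min_le_right _ _).trans (not_lt.1 fun h => hK' (hloc t' ht' h))
  have htK := mem_of_mem_nhds hK
  have hKΘ : K ⊆ F.Θ := fun y hy => (hKU hy).2
  obtain ⟨t₁, ht₁, hmax⟩ := hKc.exists_isMaxOn ⟨t, htK⟩
    ((F.continuousOn_likelihood hF hn0 x).mono hKΘ)
  have hmax' : IsMaxOn (F.likelihood x) F.Θ t₁ := fun y hy => by
    by_cases hyK : y ∈ K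
    · exact hmax hyK
    · exact (hout y hy hyK).le.trans (hmax htK)
  obtain ⟨hmem, hM⟩ := hest n x ⟨t₁, hKΘ ht₁, hmax'⟩
  by_contra hcon
  exact absurd (hM ht) (not_le.2 (hout _ hmem fun h => hcon (hKU h).1))

/-- A family dominated by the zero measure has a single parameter, by minimality. -/
lemma eq_of_base_eq_zero (F : ExpFamily 𝒳 d q) (hF : F.base = 0) {t t' : Param d} (ht : t ∈ F.Θ)
    (ht' : t' ∈ F.Θ) : t' = t := by
  have hsub : ∀ s : EuclideanSpace ℝ (Fin q), s = 0 := fun s => by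
    by_contra hs
    exact F.minimal s hs 0 (by simp [hF])
  have := F.isEmbedding_η.injective (a₁ := ⟨t', ht'⟩) (a₂ := ⟨t, ht⟩)
    ((hsub _).trans (hsub _).symm)
  exact congrArg Subtype.val this

end ExpFamily

/-- Consistency of the estimator of one treatment, as a property of individual response sequences:
either the estimate converges along every sequence, or it converges along those that satisfy the
law of large numbers for some integrable function of the response. The first alternative covers the
exponential families dominated by the zero measure. -/
theorem IsResponseModel.consistent {𝒳 : Type*} [MeasurableSpace 𝒳] {d : ℕ} {Θ : Set (Param d)}
    {θ : Param d} (hθ : θ ∈ Θ) {P : Measure 𝒳} {est : (n : ℕ) → (Fin n → 𝒳) → Param d}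
    (h : IsResponseModel Θ θ P est) :
    (∀ w : ℕ → 𝒳, Tendsto (fun n => est n (fun i => w i)) atTop (𝓝 θ)) ∨
    (IsProbabilityMeasure P ∧ ∃ (q : ℕ) (g : 𝒳 → EuclideanSpace ℝ (Fin q)), Measurable g ∧
      Integrable g P ∧ ∀ w : ℕ → 𝒳,
        Tendsto (fun n : ℕ => (n : ℝ)⁻¹ • ∑ i ∈ Finset.range n, g (w i)) atTop (𝓝 (∫ x, g x ∂P)) →
        Tendsto (fun n => est n (fun i => w i)) atTop (𝓝 θ)) := by
  rcases h with ⟨q, F, rfl, rfl, hest⟩ | ⟨hP, g, hg, hgi, rfl, hest⟩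
  · by_cases hF : F.base = 0
    · left
      intro w
      refine tendsto_const_nhds.congr fun n => ?_
      refine (F.eq_of_base_eq_zero hF hθ (hest n _ ⟨θ, hθ, fun y hy => ?_⟩).1).symm
      rw [F.eq_of_base_eq_zero hF hθ hy]
      exact le_refl (F.likelihood (fun i : Fin n => w i) θ)
    · exact Or.inr ⟨F.isProbabilityMeasure_law hF hθ, q, F.T, F.measurable_T, F.integrable_T hθ,
        fun w hw => F.tendsto_mle hF hθ hest w hw⟩
  · refine Or.inr ⟨hP, d, g, hg, hgi, fun w hw => hw.congr' ?_⟩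
    filter_upwards [eventually_gt_atTop 0] with n hn
    rw [hest n _ hn, Fin.sum_univ_eq_sum_range (fun i => g (w i))]

/-! ### Counting assignments and locating responses -/

section Design

variable {Ω 𝒳 : Type*} {X : ℕ → Ω → Fin 2} {Y : ℕ → Ω → 𝒳}

lemma numAssigned_zero (k : Fin 2) (ω : Ω) : numAssigned X 0 k ω = 0 := Nat.count_zero _

lemma numAssigned_succ (m : ℕ) (k : Fin 2) (ω : Ω) :
    numAssigned X (m + 1) k ω = numAssigned X m k ω + if X m ω = k then 1 else 0 :=
  Nat.count_succ _ _

lemma numAssigned_mono (k : Fin 2) (ω : Ω) : Monotone fun m => numAssigned X m k ω :=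
  Nat.count_monotone _

lemma numAssigned_le (m : ℕ) (k : Fin 2) (ω : Ω) : numAssigned X m k ω ≤ m :=
  Nat.count_le _

lemma numAssigned_add (m : ℕ) (ω : Ω) : numAssigned X m 0 ω + numAssigned X m 1 ω = m := by
  induction m with
  | zero => simp [numAssigned_zero]
  | succ m ih =>
    rw [numAssigned_succ, numAssigned_succ]
    rcases Fin.exists_fin_two.1 ⟨X m ω, rfl⟩ with h | h <;> simp [h] <;> omega

lemma abs_numAssigned_sub_le {ρ : ℝ} (hρ : ρ ∈ Set.Ioo (0 : ℝ) 1) (m : ℕ) (k : Fin 2) (ω : Ω) :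
    |(numAssigned X m k ω : ℝ) - m * ρ| ≤ m := by
  have h1 : (numAssigned X m k ω : ℝ) ≤ m := by exact_mod_cast numAssigned_le m k ω
  have h2 : (0 : ℝ) ≤ numAssigned X m k ω := Nat.cast_nonneg _
  have h3 : (0 : ℝ) ≤ m := Nat.cast_nonneg _
  rw [abs_le]
  constructor <;> nlinarith [hρ.1, hρ.2]

/-- The response to the `n`-th assignment to treatment `k` (counted from `0`). Where there is no
such assignment the value has no meaning. -/
noncomputable def nthResponse (X : ℕ → Ω → Fin 2) (Y : ℕ → Ω → 𝒳) (k : Fin 2)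
    (n : ℕ) (ω : Ω) : 𝒳 :=
  Y (Nat.nth (fun j => X j ω = k) n) ω

/-- The event that treatment `k` is assigned for the `n`-th time (counted from `0`) to the patient
with index `m`. -/
def assignedAt (X : ℕ → Ω → Fin 2) (k : Fin 2) (n m : ℕ) : Set Ω :=
  {ω | X m ω = k ∧ numAssigned X m k ω = n}

/-- The event that treatment `k` is assigned more than `n` times. -/
def reached (X : ℕ → Ω → Fin 2) (k : Fin 2) (n : ℕ) : Set Ω :=
  ⋃ m, assignedAt X k n m

lemma nthResponse_eq {k : Fin 2} {n m : ℕ} {ω : Ω} (h : ω ∈ assignedAt X k n m) :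
    nthResponse X Y k n ω = Y m ω := by
  obtain ⟨h1, h2⟩ := h
  unfold nthResponse
  rw [← h2]
  congr 1
  exact Nat.nth_count (p := fun j => X j ω = k) h1

lemma lt_numAssigned_of_lt {k : Fin 2} {n m m' : ℕ} {ω : Ω} (h : ω ∈ assignedAt X k n m)
    (hm : m < m') : n < numAssigned X m' k ω := by
  have h1 := numAssigned_succ (X := X) m k ω
  rw [if_pos h.1, h.2] at h1
  exact (Nat.lt_of_succ_le h1.ge).trans_le (numAssigned_mono k ω hm)

lemma disjoint_assignedAt (k : Fin 2) (n : ℕ) :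
    Pairwise (Function.onFun Disjoint (assignedAt X k n)) := by
  intro m m' hne
  refine Set.disjoint_left.2 fun ω h h' => ?_
  rcases hne.lt_or_gt with hlt | hlt
  · exact (lt_numAssigned_of_lt h hlt).ne' h'.2
  · exact (lt_numAssigned_of_lt h' hlt).ne' h.2

lemma exists_assignedAt {k : Fin 2} {n m : ℕ} {ω : Ω} (h : n < numAssigned X m k ω) :
    ∃ j < m, ω ∈ assignedAt X k n j := by
  refine ⟨Nat.nth (fun j => X j ω = k) n, Nat.nth_lt_of_lt_count h, ?_, ?_⟩
  · exact Nat.nth_mem n fun hf => h.trans_le (Nat.count_le_card hf m)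
  · exact Nat.count_nth fun hf => h.trans_le (Nat.count_le_card hf m)

lemma reached_inter_eq (k : Fin 2) (n : ℕ) (B : Set 𝒳) :
    reached X k n ∩ nthResponse X Y k n ⁻¹' B = ⋃ m, (assignedAt X k n m ∩ Y m ⁻¹' B) := by
  ext ω
  simp only [reached, Set.mem_inter_iff, Set.mem_iUnion, Set.mem_preimage]
  constructor
  · rintro ⟨⟨m, hm⟩, hB⟩
    exact ⟨m, hm, nthResponse_eq (Y := Y) hm ▸ hB⟩
  · rintro ⟨m, hm, hB⟩
    exact ⟨⟨m, hm⟩, (nthResponse_eq (Y := Y) hm).symm ▸ hB⟩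

open Classical in
/-- The responses on treatment `k`, completed by the sample `z` where treatment `k` is not assigned
often enough. -/
noncomputable def completedResponse (X : ℕ → Ω → Fin 2) (Y : ℕ → Ω → 𝒳) (k : Fin 2) (n : ℕ)
    (p : Ω × (ℕ → 𝒳)) : 𝒳 :=
  if p.1 ∈ reached X k n then nthResponse X Y k n p.1 else p.2 n

lemma preimage_completedResponse (k : Fin 2) (n : ℕ) (B : Set 𝒳) :
    completedResponse X Y k n ⁻¹' B =
      (reached X k n ∩ nthResponse X Y k n ⁻¹' B) ×ˢ Set.univ ∪
        (reached X k n)ᶜ ×ˢ {z | z n ∈ B} := by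
  ext ⟨ω, z⟩
  by_cases h : ω ∈ reached X k n <;> simp [completedResponse, h]

lemma tendsto_numAssigned_or_eventually_eq (k : Fin 2) (ω : Ω) :
    Tendsto (fun m => numAssigned X m k ω) atTop atTop ∨
      ∃ l, ∀ᶠ m in atTop, numAssigned X m k ω = l := by
  refine (tendsto_atTop_of_monotone (numAssigned_mono (X := X) k ω)).imp_right fun ⟨l, hl⟩ => ⟨l, ?_⟩
  rwa [nhds_discrete, tendsto_pure] at hl

lemma tendsto_numAssigned_of_frequently {k : Fin 2} {ω : Ω} (h : ∃ᶠ m in atTop, X m ω = k) :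
    Tendsto (fun m => numAssigned X m k ω) atTop atTop := by
  refine (tendsto_numAssigned_or_eventually_eq k ω).resolve_right fun ⟨l, hl⟩ => h ?_
  filter_upwards [hl, (tendsto_add_atTop_nat 1).eventually hl] with m h1 h2 h3
  rw [numAssigned_succ, if_pos h3, h1] at h2
  omega

/-! ### The history of the trial -/

variable [MeasurableSpace 𝒳]

lemma measurable_pair_history {j m : ℕ} (hj : j < m) :
    Measurable[history X Y m] (fun ω => (X j ω, Y j ω)) :=
  (measurable_pi_apply (X := fun _ : Fin m => Fin 2 × 𝒳) (⟨j, hj⟩ : Fin m)).comp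
    (comap_measurable (fun ω (j : Fin m) => (X j ω, Y j ω)))

lemma measurable_X_history {j m : ℕ} (hj : j < m) : Measurable[history X Y m] (X j) :=
  measurable_fst.comp (measurable_pair_history (Y := Y) hj)

lemma measurable_Y_history {j m : ℕ} (hj : j < m) : Measurable[history X Y m] (Y j) :=
  measurable_snd.comp (measurable_pair_history (X := X) hj)

lemma history_mono : Monotone (history X Y) := by
  intro m n hmn
  refine Measurable.comap_le (@measurable_pi_lambda _ _ _ (history X Y n) _ _ fun j => ?_)
  exact measurable_pair_history (j.2.trans_le hmn)

lemma measurable_numAssigned_history (m : ℕ) (k : Fin 2) :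
    Measurable[history X Y m] (numAssigned X m k) := by
  suffices h : ∀ n, m ≤ n → Measurable[history X Y n] (numAssigned X m k) from h m le_rfl
  induction m with
  | zero =>
    intro n _
    have : numAssigned X 0 k = fun _ => 0 := funext fun ω => numAssigned_zero k ω
    rw [this]
    exact measurable_const
  | succ m ih =>
    intro n hn
    have : numAssigned X (m + 1) k =
        fun ω => numAssigned X m k ω + if X m ω = k then 1 else 0 :=
      funext fun ω => numAssigned_succ m k ω
    rw [this]
    refine (ih n (Nat.le_of_succ_le hn)).add (Measurable.ite ?_ measurable_const measurable_const)
    exact measurable_X_history hn (measurableSet_singleton k)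

lemma measurable_numAssigned_cast (m : ℕ) (k : Fin 2) :
    Measurable[history X Y m] fun ω => (numAssigned X m k ω : ℝ) :=
  (measurable_from_top (f := fun n : ℕ => (n : ℝ))).comp (measurable_numAssigned_history m k)

variable [MeasurableSpace Ω]

lemma history_le (hX : ∀ m, Measurable (X m)) (hY : ∀ m, Measurable (Y m)) (m : ℕ) :
    history X Y m ≤ ‹MeasurableSpace Ω› :=
  Measurable.comap_le (measurable_pi_lambda _ fun j => (hX j).prodMk (hY j))

/-! ### The law of large numbers on one treatment

The response to the `n`-th assignment to a treatment is defined only where that assignment takes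
place. Completed there by an independent sample, these responses form a sequence of pairwise
independent, identically distributed variables. -/

lemma measurableSet_assignedAt (hX : ∀ m, Measurable (X m)) (hY : ∀ m, Measurable (Y m))
    (k : Fin 2) (n m : ℕ) : MeasurableSet (assignedAt X k n m) := by
  refine (hX m (measurableSet_singleton k)).inter ?_
  exact history_le hX hY m _ (measurable_numAssigned_history m k (measurableSet_singleton n))

lemma measurableSet_reached (hX : ∀ m, Measurable (X m)) (hY : ∀ m, Measurable (Y m))
    (k : Fin 2) (n : ℕ) : MeasurableSet (reached X k n) :=
  MeasurableSet.iUnion fun m => measurableSet_assignedAt hX hY k n m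

lemma measurableSet_reached_inter (hX : ∀ m, Measurable (X m)) (hY : ∀ m, Measurable (Y m))
    (k : Fin 2) (n : ℕ) {B : Set 𝒳} (hB : MeasurableSet B) :
    MeasurableSet (reached X k n ∩ nthResponse X Y k n ⁻¹' B) := by
  rw [reached_inter_eq]
  exact MeasurableSet.iUnion fun m => (measurableSet_assignedAt hX hY k n m).inter (hY m hB)

/-- The response to an assignment to treatment `k` has distribution `P` given the history. -/
def ResponseLaw (μ : Measure Ω) (X : ℕ → Ω → Fin 2) (Y : ℕ → Ω → 𝒳) (k : Fin 2)
    (P : Measure 𝒳) : Prop :=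
  ∀ (m : ℕ) (B : Set 𝒳), MeasurableSet B →
    μ[({ω | X m ω = k ∧ Y m ω ∈ B} : Set Ω).indicator (fun _ => (1 : ℝ)) | history X Y m]
      =ᵐ[μ] fun ω => P.real B * allocProb μ X Y m k ω

variable {μ : Measure Ω} [IsProbabilityMeasure μ]

/-- The defining property of the conditional response law, integrated over an event `H` of the
history. -/
lemma measure_response_inter (hX : ∀ m, Measurable (X m)) (hY : ∀ m, Measurable (Y m)) {k : Fin 2}
    {P : Measure 𝒳} [IsProbabilityMeasure P] (hP : ResponseLaw μ X Y k P) (m : ℕ) {B : Set 𝒳}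
    (hB : MeasurableSet B) {H : Set Ω} (hH : MeasurableSet[history X Y m] H) :
    μ ({ω | X m ω = k ∧ Y m ω ∈ B} ∩ H) = P B * μ ({ω | X m ω = k} ∩ H) := by
  have hle := history_le hX hY m
  have hA : MeasurableSet {ω | X m ω = k} := hX m (measurableSet_singleton k)
  have hAB : MeasurableSet {ω | X m ω = k ∧ Y m ω ∈ B} := hA.inter (hY m hB)
  have key : ∀ S : Set Ω, MeasurableSet S →
      ∫ ω in H, (μ[S.indicator (fun _ => (1 : ℝ)) | history X Y m]) ω ∂μ = μ.real (S ∩ H) := by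
    intro S hS
    rw [setIntegral_condExp hle ((integrable_const _).indicator hS) hH, integral_indicator hS,
      Measure.restrict_restrict hS, setIntegral_const, smul_eq_mul, mul_one]
  have h1 := key _ hAB
  rw [setIntegral_congr_ae (hle _ hH) ((hP m B hB).mono fun ω h _ => h), integral_const_mul] at h1
  rw [show ∫ ω in H, allocProb μ X Y m k ω ∂μ = μ.real ({ω | X m ω = k} ∩ H) from key _ hA] at h1
  rw [← ENNReal.toReal_eq_toReal_iff' (measure_ne_top _ _)
    (ENNReal.mul_ne_top (measure_ne_top _ _) (measure_ne_top _ _)), ENNReal.toReal_mul]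
  exact h1.symm

/-- The response to the `n`-th assignment is independent of the events `C` that are determined
by the history up to that assignment. -/
lemma measure_nthResponse_inter (hX : ∀ m, Measurable (X m)) (hY : ∀ m, Measurable (Y m))
    {k : Fin 2} {P : Measure 𝒳} [IsProbabilityMeasure P] (hP : ResponseLaw μ X Y k P) (n : ℕ)
    {B : Set 𝒳} (hB : MeasurableSet B) {C : Set Ω} (hCm : MeasurableSet C)
    (hC : ∀ m, MeasurableSet[history X Y m] ({ω | numAssigned X m k ω = n} ∩ C)) :
    μ (reached X k n ∩ nthResponse X Y k n ⁻¹' B ∩ C) = P B * μ (reached X k n ∩ C) := by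
  rw [reached_inter_eq, reached, Set.iUnion_inter, Set.iUnion_inter, measure_iUnion, measure_iUnion,
    ← ENNReal.tsum_mul_left]
  · refine tsum_congr fun m => ?_
    have h := measure_response_inter hX hY hP m hB (hC m)
    convert h using 2
    · ext ω; simp only [assignedAt, Set.mem_inter_iff, Set.mem_ofPred_eq, Set.mem_preimage]; tauto
    · congr 1
      ext ω; simp only [assignedAt, Set.mem_inter_iff, Set.mem_ofPred_eq]; tauto
  · exact fun m m' h => (disjoint_assignedAt k n h).mono Set.inter_subset_left Set.inter_subset_left
  · exact fun m => (measurableSet_assignedAt hX hY k n m).inter hCm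
  · exact fun m m' h => (disjoint_assignedAt k n h).mono
      (Set.inter_subset_left.trans Set.inter_subset_left)
      (Set.inter_subset_left.trans Set.inter_subset_left)
  · exact fun m => ((measurableSet_assignedAt hX hY k n m).inter (hY m hB)).inter hCm

lemma measure_nthResponse (hX : ∀ m, Measurable (X m)) (hY : ∀ m, Measurable (Y m))
    {k : Fin 2} {P : Measure 𝒳} [IsProbabilityMeasure P] (hP : ResponseLaw μ X Y k P) (n : ℕ)
    {B : Set 𝒳} (hB : MeasurableSet B) :
    μ (reached X k n ∩ nthResponse X Y k n ⁻¹' B) = P B * μ (reached X k n) := by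
  have := measure_nthResponse_inter hX hY hP n hB MeasurableSet.univ fun m => by
    rw [Set.inter_univ]
    exact measurable_numAssigned_history m k (measurableSet_singleton n)
  simpa using this

lemma measure_nthResponse_pair (hX : ∀ m, Measurable (X m)) (hY : ∀ m, Measurable (Y m))
    {k : Fin 2} {P : Measure 𝒳} [IsProbabilityMeasure P] (hP : ResponseLaw μ X Y k P) {i n : ℕ}
    (hin : i < n) {A B : Set 𝒳} (hA : MeasurableSet A) (hB : MeasurableSet B) :
    μ (reached X k n ∩ nthResponse X Y k n ⁻¹' B ∩ (reached X k i ∩ nthResponse X Y k i ⁻¹' A)) =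
      P B * μ (reached X k n ∩ (reached X k i ∩ nthResponse X Y k i ⁻¹' A)) := by
  refine measure_nthResponse_inter hX hY hP n hB (measurableSet_reached_inter hX hY k i hA)
    fun m => ?_
  have : {ω | numAssigned X m k ω = n} ∩ (reached X k i ∩ nthResponse X Y k i ⁻¹' A) =
      {ω | numAssigned X m k ω = n} ∩
        ⋃ j, ⋃ (_ : j < m), (assignedAt X k i j ∩ Y j ⁻¹' A) := by
    rw [reached_inter_eq]
    ext ω
    simp only [Set.mem_inter_iff, Set.mem_ofPred_eq, Set.mem_iUnion, exists_prop]
    refine and_congr_right fun hn => ⟨?_, fun ⟨j, _, h⟩ => ⟨j, h⟩⟩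
    rintro ⟨j, hj, hjA⟩
    obtain ⟨j', hj', h'⟩ := exists_assignedAt (X := X) (k := k) (m := m) (hin.trans_eq hn.symm)
    have : j = j' := by
      by_contra hne
      exact Set.disjoint_left.1 (disjoint_assignedAt k i hne) hj h'
    exact ⟨j, this ▸ hj', hj, hjA⟩
  rw [this]
  refine MeasurableSet.inter (measurable_numAssigned_history m k (measurableSet_singleton n)) ?_
  refine MeasurableSet.iUnion fun j => MeasurableSet.iUnion fun hj => ?_
  refine MeasurableSet.inter (MeasurableSet.inter ?_ ?_) (measurable_Y_history hj hA)
  · exact measurable_X_history hj (measurableSet_singleton k)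
  · exact history_mono hj.le _ (measurable_numAssigned_history j k (measurableSet_singleton i))

lemma measurable_completedResponse (hX : ∀ m, Measurable (X m)) (hY : ∀ m, Measurable (Y m))
    (k : Fin 2) (n : ℕ) : Measurable (completedResponse X Y k n) := by
  intro B hB
  rw [preimage_completedResponse]
  exact ((measurableSet_reached_inter hX hY k n hB).prod MeasurableSet.univ).union
    ((measurableSet_reached hX hY k n).compl.prod (measurable_pi_apply n hB))

lemma infinitePi_coord {P : Measure 𝒳} [IsProbabilityMeasure P] (n : ℕ) {B : Set 𝒳}
    (hB : MeasurableSet B) : Measure.infinitePi (fun _ : ℕ => P) {z | z n ∈ B} = P B := by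
  have h := Measure.infinitePi_map_eval (fun _ : ℕ => P) n
  calc _ = (Measure.infinitePi fun _ : ℕ => P).map (fun z => z n) B :=
        (Measure.map_apply (measurable_pi_apply n) hB).symm
    _ = P B := by rw [h]

lemma infinitePi_coord_pair {P : Measure 𝒳} [IsProbabilityMeasure P] {i n : ℕ} (hin : i ≠ n)
    {A B : Set 𝒳} (hA : MeasurableSet A) (hB : MeasurableSet B) :
    Measure.infinitePi (fun _ : ℕ => P) ({z | z n ∈ B} ∩ {z | z i ∈ A}) = P B * P A := by
  have h := (iIndepFun_infinitePi (P := fun _ : ℕ => P) (X := fun _ x => x)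
    (fun _ => measurable_id)).indepFun hin.symm
  rw [← infinitePi_coord (P := P) n hB, ← infinitePi_coord (P := P) i hA]
  exact h.measure_inter_preimage_eq_mul _ _ hB hA

lemma measure_completedResponse (hX : ∀ m, Measurable (X m)) (hY : ∀ m, Measurable (Y m))
    {k : Fin 2} {P : Measure 𝒳} [IsProbabilityMeasure P] (hP : ResponseLaw μ X Y k P) (n : ℕ)
    {B : Set 𝒳} (hB : MeasurableSet B) :
    (μ.prod (Measure.infinitePi fun _ : ℕ => P)) (completedResponse X Y k n ⁻¹' B) = P B := by
  have hR := measurableSet_reached (k := k) (n := n) hX hY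
  rw [preimage_completedResponse, measure_union, Measure.prod_prod, Measure.prod_prod, measure_univ,
    mul_one, infinitePi_coord n hB, measure_nthResponse hX hY hP n hB, mul_comm, ← add_mul,
    measure_add_measure_compl hR, measure_univ, one_mul]
  · exact Set.disjoint_prod.2 (Or.inl (disjoint_compl_right.mono_left Set.inter_subset_left))
  · exact hR.compl.prod (measurable_pi_apply n hB)

/-- Pairwise independence of the completed responses. The event is split according to whether the
later assignment takes place, only the earlier one does, or neither. -/
lemma measure_completedResponse_pair (hX : ∀ m, Measurable (X m)) (hY : ∀ m, Measurable (Y m))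
    {k : Fin 2} {P : Measure 𝒳} [IsProbabilityMeasure P] (hP : ResponseLaw μ X Y k P) {i n : ℕ}
    (hin : i < n) {A B : Set 𝒳} (hA : MeasurableSet A) (hB : MeasurableSet B) :
    (μ.prod (Measure.infinitePi fun _ : ℕ => P))
      (completedResponse X Y k n ⁻¹' B ∩ completedResponse X Y k i ⁻¹' A) = P B * P A := by
  set ν := Measure.infinitePi fun _ : ℕ => P
  set Fn := reached X k n
  set Fi := reached X k i
  set a := Fi ∩ nthResponse X Y k i ⁻¹' A with ha
  have hFn : MeasurableSet Fn := measurableSet_reached hX hY k n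
  have hFi : MeasurableSet Fi := measurableSet_reached hX hY k i
  have ham : MeasurableSet a := measurableSet_reached_inter hX hY k i hA
  have hsub : Fn ⊆ Fi := fun ω hω => by
    obtain ⟨m, hm⟩ := Set.mem_iUnion.1 hω
    obtain ⟨j, _, hj⟩ := exists_assignedAt (X := X) (k := k) (m := m) (hin.trans_eq hm.2.symm)
    exact Set.mem_iUnion.2 ⟨j, hj⟩
  have hBn : MeasurableSet {z : ℕ → 𝒳 | z n ∈ B} := measurable_pi_apply n hB
  have hAi : MeasurableSet {z : ℕ → 𝒳 | z i ∈ A} := measurable_pi_apply i hA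
  have hset : completedResponse X Y k n ⁻¹' B ∩ completedResponse X Y k i ⁻¹' A =
      (Fn ∩ nthResponse X Y k n ⁻¹' B ∩ a) ×ˢ Set.univ ∪
        ((Fnᶜ ∩ a) ×ˢ {z : ℕ → 𝒳 | z n ∈ B} ∪
          Fiᶜ ×ˢ ({z : ℕ → 𝒳 | z n ∈ B} ∩ {z : ℕ → 𝒳 | z i ∈ A})) := by
    rw [preimage_completedResponse, preimage_completedResponse]
    ext ⟨ω, z⟩
    have := @hsub ω
    simp only [ha, Set.mem_inter_iff, Set.mem_union, Set.mem_prod, Set.mem_univ, Set.mem_compl_iff,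
      Set.mem_ofPred_eq, and_true]
    tauto
  have h1 : μ.prod ν (completedResponse X Y k i ⁻¹' A) = μ a + μ Fiᶜ * P A := by
    rw [preimage_completedResponse, measure_union, Measure.prod_prod, Measure.prod_prod,
      measure_univ, mul_one, infinitePi_coord i hA]
    · exact Set.disjoint_prod.2 (Or.inl (disjoint_compl_right.mono_left Set.inter_subset_left))
    · exact hFi.compl.prod hAi
  rw [measure_completedResponse hX hY hP i hA] at h1
  have h2 : μ a = μ (Fn ∩ a) + μ (Fnᶜ ∩ a) := by
    rw [Set.inter_comm Fn, Set.inter_comm Fnᶜ, ← Set.sdiff_eq, measure_inter_add_sdiff a hFn]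
  rw [hset, measure_union, measure_union, Measure.prod_prod, Measure.prod_prod, Measure.prod_prod,
    measure_univ, mul_one, infinitePi_coord n hB, infinitePi_coord_pair hin.ne hA hB,
    measure_nthResponse_pair hX hY hP hin hA hB]
  · conv_rhs => rw [h1, h2]
    ring
  · exact Set.disjoint_prod.2 (Or.inl (disjoint_compl_right.mono_left
      (Set.inter_subset_right.trans Set.inter_subset_left)))
  · exact hFi.compl.prod (hBn.inter hAi)
  · refine Set.disjoint_union_right.2 ⟨Set.disjoint_prod.2 (Or.inl ?_),
      Set.disjoint_prod.2 (Or.inl ?_)⟩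
    · exact disjoint_compl_right.mono (Set.inter_subset_left.trans Set.inter_subset_left)
        Set.inter_subset_left
    · exact disjoint_compl_right.mono_left (Set.inter_subset_right.trans Set.inter_subset_left)
  · exact ((hFn.compl.inter ham).prod hBn).union (hFi.compl.prod (hBn.inter hAi))

/-- The strong law of large numbers for the responses on treatment `k`, on the event that this
treatment is assigned infinitely often. -/
theorem ae_tendsto_average_nthResponse (hX : ∀ m, Measurable (X m)) (hY : ∀ m, Measurable (Y m))
    {k : Fin 2} {P : Measure 𝒳} [IsProbabilityMeasure P] (hP : ResponseLaw μ X Y k P)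
    {q : ℕ} {g : 𝒳 → EuclideanSpace ℝ (Fin q)} (hg : Measurable g) (hgi : Integrable g P) :
    ∀ᵐ ω ∂μ, Tendsto (fun m => numAssigned X m k ω) atTop atTop →
      Tendsto (fun n : ℕ => (n : ℝ)⁻¹ • ∑ i ∈ Finset.range n, g (nthResponse X Y k i ω)) atTop
        (𝓝 (∫ x, g x ∂P)) := by
  set ν := Measure.infinitePi fun _ : ℕ => P
  have hW := fun n => measurable_completedResponse (k := k) (n := n) hX hY
  have hmap : ∀ n, (μ.prod ν).map (completedResponse X Y k n) = P := fun n => by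
    ext B hB
    rw [Measure.map_apply (hW n) hB, measure_completedResponse hX hY hP n hB]
  have hindep : Pairwise fun i j => IndepFun (completedResponse X Y k i) (completedResponse X Y k j)
      (μ.prod ν) := by
    have hlt : ∀ i j, i < j → IndepFun (completedResponse X Y k j) (completedResponse X Y k i)
        (μ.prod ν) := fun i j hij => by
      rw [indepFun_iff_measure_inter_preimage_eq_mul]
      intro B A hB hA
      rw [measure_completedResponse_pair hX hY hP hij hA hB, measure_completedResponse hX hY hP _ hB,
        measure_completedResponse hX hY hP _ hA]
    intro i j hij
    rcases hij.lt_or_gt with h | h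
    · exact (hlt i j h).symm
    · exact hlt j i h
  have hslln := strong_law_ae (μ := μ.prod ν) (fun n p => g (completedResponse X Y k n p))
    (by
      have : Integrable g ((μ.prod ν).map (completedResponse X Y k 0)) := by rwa [hmap]
      exact this.comp_measurable (hW 0))
    (fun i j hij => (hindep hij).comp hg hg)
    (fun i => (IdentDistrib.mk (hW i).aemeasurable (hW 0).aemeasurable
      (by rw [hmap, hmap])).comp hg)
  have hmean : ∫ p, g (completedResponse X Y k 0 p) ∂(μ.prod ν) = ∫ x, g x ∂P := by
    rw [← integral_map (hW 0).aemeasurable hg.aestronglyMeasurable, hmap]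
  rw [hmean] at hslln
  filter_upwards [Measure.ae_ae_of_ae_prod hslln] with ω hω hN
  obtain ⟨z, hz⟩ := hω.exists
  have hreach : ∀ n, ω ∈ reached X k n := fun n => by
    obtain ⟨m, hm⟩ := (hN.eventually_gt_atTop n).exists
    obtain ⟨j, _, hj⟩ := exists_assignedAt hm
    exact Set.mem_iUnion.2 ⟨j, hj⟩
  simpa [completedResponse, hreach] using hz

end Design

/-! ### Consistency of the estimates along the trial -/

lemma tendsto_sum_atTop_of_eventually_le {f : ℕ → ℝ} {ε : ℝ} (hε : 0 < ε)
    (h : ∀ᶠ n in atTop, ε ≤ f n) :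
    Tendsto (fun n => ∑ i ∈ Finset.range n, f i) atTop atTop := by
  obtain ⟨M, hM⟩ := eventually_atTop.1 h
  rw [← tendsto_add_atTop_iff_nat M]
  have h1 : ∀ n, (∑ i ∈ Finset.range M, f i) + n * ε ≤ ∑ i ∈ Finset.range (n + M), f i := by
    intro n
    rw [add_comm n M, Finset.sum_range_add]
    gcongr
    calc (n : ℝ) * ε = ∑ _i ∈ Finset.range n, ε := by simp
      _ ≤ _ := Finset.sum_le_sum fun i _ => hM _ (Nat.le_add_right _ _)
  exact tendsto_atTop_mono h1 (tendsto_atTop_add_const_left _ _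
    (tendsto_natCast_atTop_atTop.atTop_mul_const hε))

section Design

variable {Ω 𝒳 : Type*} [MeasurableSpace 𝒳] {X : ℕ → Ω → Fin 2} {Y : ℕ → Ω → 𝒳}
  [mΩ : MeasurableSpace Ω]

lemma measurable_estimate (hX : ∀ m, Measurable (X m)) (hY : ∀ m, Measurable (Y m))
    {d : Fin 2 → ℕ} {est : (k : Fin 2) → (n : ℕ) → (Fin n → 𝒳) → Param (d k)}
    (hest : ∀ k n, Measurable (est k n)) (m : ℕ) : Measurable (estimate est X Y m) := by
  refine measurable_pi_lambda _ fun k => ?_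
  -- on `N_{m,k} = n` the first `n` responses agree with the completed ones, which are measurable
  set h : ℕ → Ω → Param (d k) := fun n ω =>
    est k n fun i => completedResponse X Y k i (ω, fun _ => Y 0 ω)
  have hh : ∀ n, Measurable (h n) := fun n => (hest k n).comp <|
    measurable_pi_lambda _ fun i => (measurable_completedResponse hX hY k i).comp <|
      measurable_id.prodMk <| measurable_pi_lambda _ fun _ => hY 0
  have heq : (fun ω => estimate est X Y m ω k) = fun ω => h (numAssigned X m k ω) ω := by
    funext ω
    simp only [estimate, h]
    congr 1
    funext i
    obtain ⟨j, _, hj⟩ := exists_assignedAt i.2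
    have hr : ω ∈ reached X k i := Set.mem_iUnion.2 ⟨j, hj⟩
    simp only [completedResponse, hr, if_true]
    rfl
  rw [heq]
  have hN : Measurable (numAssigned X m k) :=
    (measurable_numAssigned_history (Y := Y) m k).mono (history_le hX hY m) le_rfl
  exact (measurable_from_prod_countable_right (f := fun p : ℕ × Ω => h p.1 p.2) hh).comp
    (hN.prodMk measurable_id)

variable {μ : Measure Ω} [IsProbabilityMeasure μ]

/-- On the event that treatment `k` is assigned infinitely often, its estimates are consistent. -/
lemma ae_tendsto_estimate (hX : ∀ m, Measurable (X m)) (hY : ∀ m, Measurable (Y m))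
    {d : Fin 2 → ℕ} {est : (k : Fin 2) → (n : ℕ) → (Fin n → 𝒳) → Param (d k)} {k : Fin 2}
    {Θ : Set (Param (d k))} {θ : Param (d k)} (hθ : θ ∈ Θ) {P : Measure 𝒳}
    (hP : ResponseLaw μ X Y k P) (hmodel : IsResponseModel Θ θ P (est k)) :
    ∀ᵐ ω ∂μ, Tendsto (fun m => numAssigned X m k ω) atTop atTop →
      Tendsto (fun m => estimate est X Y m ω k) atTop (𝓝 θ) := by
  rcases hmodel.consistent hθ with h | ⟨hPp, q, g, hg, hgi, h⟩
  · exact Eventually.of_forall fun ω hN => (h fun i => nthResponse X Y k i ω).comp hN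
  · filter_upwards [ae_tendsto_average_nthResponse hX hY hP hg hgi] with ω hω hN
    exact (h (fun i => nthResponse X Y k i ω) (hω hN)).comp hN

lemma allocProb_one (hX : ∀ m, Measurable (X m)) (hY : ∀ m, Measurable (Y m)) (m : ℕ) :
    allocProb μ X Y m 1 =ᵐ[μ] fun ω => 1 - allocProb μ X Y m 0 ω := by
  have hle := history_le hX hY m
  have hA : MeasurableSet {ω | X m ω = 0} := hX m (measurableSet_singleton 0)
  have hind : ({ω | X m ω = 1} : Set Ω).indicator (fun _ => (1 : ℝ)) =
      (fun _ => (1 : ℝ)) - ({ω | X m ω = 0} : Set Ω).indicator (fun _ => (1 : ℝ)) := by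
    funext ω
    rcases Fin.exists_fin_two.1 ⟨X m ω, rfl⟩ with h | h <;> simp [Set.indicator, h]
  have h := condExp_sub (μ := μ) (integrable_const (1 : ℝ))
    ((integrable_const (1 : ℝ)).indicator hA) (history X Y m)
  rw [condExp_const hle, ← hind] at h
  exact h

/-- Lévy's conditional Borel–Cantelli lemma for the assignments. -/
lemma ae_frequently_assigned_iff (hX : ∀ m, Measurable (X m)) (hY : ∀ m, Measurable (Y m))
    (k : Fin 2) : ∀ᵐ ω ∂μ, (∃ᶠ m in atTop, X m ω = k) ↔
      Tendsto (fun n => ∑ m ∈ Finset.range n, allocProb μ X Y m k ω) atTop atTop := by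
  let ℱ : Filtration ℕ mΩ := ⟨history X Y, history_mono, history_le hX hY⟩
  let s : ℕ → Set Ω := fun n => Nat.casesOn n ∅ fun m => {ω | X m ω = k}
  have hs : ∀ n, MeasurableSet[ℱ n] (s n) := fun n => by
    cases n with
    | zero => exact @MeasurableSet.empty _ (history X Y 0)
    | succ m => exact measurable_X_history (Nat.lt_succ_self m) (measurableSet_singleton k)
  filter_upwards [ae_mem_limsup_atTop_iff μ hs] with ω hω
  rw [mem_limsup_iff_frequently_mem] at hω
  have hshift : (∃ᶠ m in atTop, X m ω = k) ↔ ∃ᶠ n in atTop, ω ∈ s n := by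
    conv_rhs => rw [← map_add_atTop_eq_nat 1, frequently_map]
    exact Iff.rfl
  rw [hshift]
  exact hω


variable {d : Fin 2 → ℕ} {α : ℝ} {ρ₁ : ((k : Fin 2) → Param (d k)) → ℝ}
  {est : (k : Fin 2) → (n : ℕ) → (Fin n → 𝒳) → Param (d k)} {P : Fin 2 → Measure 𝒳} {m₀ : ℕ}
  {Θ : (k : Fin 2) → Set (Param (d k))} {θ : (k : Fin 2) → Param (d k)}

/-- Both treatments are assigned infinitely often. If one of them were not, its estimate would
become constant and the other one consistent, so that the estimated target would converge inside
`(0, 1)`; the proportion of the neglected treatment would then stay below its target, and its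
allocation probability above `1 - α`. -/
theorem IsERADE.ae_tendsto_numAssigned (hα : α ∈ Set.Ico (0 : ℝ) 1)
    (hdesign : IsERADE μ α ρ₁ est P m₀ X Y) (hθ : ∀ k, θ k ∈ Θ k)
    (hmodel : ∀ k, IsResponseModel (Θ k) (θ k) (P k) (est k))
    (hρ_cont : ContinuousOn ρ₁ (Set.univ.pi Θ))
    (hρ_mem : ∀ t ∈ Set.univ.pi Θ, ρ₁ t ∈ Set.Ioo (0 : ℝ) 1)
    (hest_mem : ∀ m, m₀ ≤ m → ∀ᵐ ω ∂μ, estimate est X Y m ω ∈ Set.univ.pi Θ) :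
    ∀ᵐ ω ∂μ, ∀ k, Tendsto (fun m => numAssigned X m k ω) atTop atTop := by
  have hX := hdesign.measurable_X
  have hY := hdesign.measurable_Y
  have h1 := ae_all_iff.2 fun k =>
    ae_tendsto_estimate hX hY (hθ k) (fun m => hdesign.response m k) (hmodel k)
  have h2 := ae_all_iff.2 fun m => ae_all_iff.2 fun hm : m₀ ≤ m => hest_mem m hm
  have h3 := ae_all_iff.2 fun m => ae_all_iff.2 fun hm : m₀ ≤ m => hdesign.allocation m hm
  have h4 := ae_all_iff.2 fun m => allocProb_one (μ := μ) hX hY m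
  have h5 := ae_all_iff.2 fun k => ae_frequently_assigned_iff (μ := μ) hX hY k
  filter_upwards [h1, h2, h3, h4, h5] with ω hcons hmem halloc hone hlevy k
  refine (tendsto_numAssigned_or_eventually_eq k ω).resolve_right fun ⟨l, hl⟩ => ?_
  -- the number of assignments to the other treatment tends to infinity
  have hother : ∀ j, j ≠ k → Tendsto (fun m => numAssigned X m j ω) atTop atTop := fun j hj => by
    refine (tendsto_numAssigned_or_eventually_eq j ω).resolve_right fun ⟨l', hl'⟩ => ?_
    obtain ⟨m, hm1, hm2, hm3⟩ := (hl.and (hl'.and (eventually_gt_atTop (l + l')))).exists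
    have hadd := numAssigned_add (X := X) m ω
    have : numAssigned X m 0 ω + numAssigned X m 1 ω =
        numAssigned X m k ω + numAssigned X m j ω := by
      fin_cases k <;> fin_cases j <;> first | exact absurd rfl hj | rfl | exact add_comm _ _
    omega
  obtain ⟨t, ht, htend⟩ : ∃ t ∈ Set.univ.pi Θ,
      Tendsto (fun m => estimate est X Y m ω) atTop (𝓝 t) := by
    obtain ⟨M, hM⟩ := eventually_atTop.1 hl
    have hconst : ∀ᶠ m in atTop, estimate est X Y m ω k =
        est k l fun i => nthResponse X Y k i ω := by
      filter_upwards [hl] with m hm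
      have : ∀ n, n = l → (est k n fun i => nthResponse X Y k i ω) =
          est k l fun i => nthResponse X Y k i ω := by rintro _ rfl; rfl
      exact this _ hm
    refine ⟨Function.update θ k (est k l fun i => nthResponse X Y k i ω), fun j _ => ?_, ?_⟩
    · by_cases hj : j = k
      · subst hj
        obtain ⟨m, hm1, hm2⟩ := (hconst.and (eventually_ge_atTop m₀)).exists
        rw [Function.update_self, ← hm1]
        exact hmem m hm2 j (Set.mem_univ j)
      · rw [Function.update_of_ne hj]
        exact hθ j
    · refine tendsto_pi_nhds.2 fun j => ?_
      by_cases hj : j = k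
      · subst hj
        rw [Function.update_self]
        exact tendsto_const_nhds.congr' (hconst.mono fun m hm => hm.symm)
      · rw [Function.update_of_ne hj]
        exact hcons j (hother j hj)
  have hρt : Tendsto (fun m => ρ₁ (estimate est X Y m ω)) atTop (𝓝 (ρ₁ t)) :=
    (hρ_cont t ht).tendsto.comp (tendsto_nhdsWithin_iff.2
      ⟨htend, (eventually_ge_atTop m₀).mono fun m hm => hmem m hm⟩)
  have hfrac : Tendsto (fun m => (numAssigned X m k ω : ℝ) / m) atTop (𝓝 0) := by
    refine (tendsto_const_div_atTop_nhds_zero_nat (l : ℝ)).congr' ?_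
    filter_upwards [hl] with m hm
    rw [hm]
  have hprob : ∀ᶠ m in atTop, 1 - α ≤ allocProb μ X Y m k ω := by
    obtain rfl | rfl : k = 0 ∨ k = 1 := by fin_cases k <;> simp
    · filter_upwards [hfrac.eventually_lt hρt (hρ_mem t ht).1, eventually_ge_atTop m₀] with m hlt hm
      have hr := hρ_mem _ (hmem m hm)
      rw [halloc m hm, eradeProb, if_neg hlt.le.not_gt, if_neg hlt.ne]
      nlinarith [hr.1, hα.1]
    · have hfrac0 : Tendsto (fun m => (numAssigned X m 0 ω : ℝ) / m) atTop (𝓝 1) := by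
        have h : Tendsto (fun m : ℕ => 1 - (numAssigned X m 1 ω : ℝ) / m) atTop (𝓝 (1 - 0)) :=
          hfrac.const_sub 1
        rw [sub_zero] at h
        refine h.congr' ?_
        filter_upwards [eventually_gt_atTop 0] with m hm
        have hadd : (numAssigned X m 0 ω : ℝ) + numAssigned X m 1 ω = m := by
          exact_mod_cast numAssigned_add (X := X) m ω
        have hm' : (m : ℝ) ≠ 0 := by exact_mod_cast hm.ne'
        field_simp
        linarith
      filter_upwards [hρt.eventually_lt hfrac0 (hρ_mem t ht).2, eventually_ge_atTop m₀] with m hlt hm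
      have hr := hρ_mem _ (hmem m hm)
      rw [hone m, halloc m hm, eradeProb, if_pos hlt]
      nlinarith [hr.2, hα.1]
  obtain ⟨m, hm⟩ := ((tendsto_numAssigned_of_frequently ((hlevy k).2
    (tendsto_sum_atTop_of_eventually_le (sub_pos.2 hα.2) hprob))).eventually_gt_atTop l |>.and
      hl).exists
  exact hm.1.ne' hm.2

/-- The estimated target allocation proportion is consistent. -/
theorem IsERADE.ae_tendsto_target (hα : α ∈ Set.Ico (0 : ℝ) 1)
    (hdesign : IsERADE μ α ρ₁ est P m₀ X Y) (hθ : ∀ k, θ k ∈ Θ k)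
    (hmodel : ∀ k, IsResponseModel (Θ k) (θ k) (P k) (est k))
    (hρ_cont : ContinuousOn ρ₁ (Set.univ.pi Θ))
    (hρ_mem : ∀ t ∈ Set.univ.pi Θ, ρ₁ t ∈ Set.Ioo (0 : ℝ) 1)
    (hest_mem : ∀ m, m₀ ≤ m → ∀ᵐ ω ∂μ, estimate est X Y m ω ∈ Set.univ.pi Θ) :
    ∀ᵐ ω ∂μ, Tendsto (fun m => ρ₁ (estimate est X Y m ω)) atTop (𝓝 (ρ₁ θ)) := by
  have h1 := ae_all_iff.2 fun k => ae_tendsto_estimate hdesign.measurable_X hdesign.measurable_Y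
    (hθ k) (fun m => hdesign.response m k) (hmodel k)
  have h2 := ae_all_iff.2 fun m => ae_all_iff.2 fun hm : m₀ ≤ m => hest_mem m hm
  filter_upwards [h1, h2, hdesign.ae_tendsto_numAssigned hα hθ hmodel hρ_cont hρ_mem hest_mem]
    with ω hcons hmem hN
  exact (hρ_cont θ fun k _ => hθ k).tendsto.comp (tendsto_nhdsWithin_iff.2
    ⟨tendsto_pi_nhds.2 fun k => hcons k (hN k),
      (eventually_ge_atTop m₀).mono fun m hm => hmem m hm⟩)

end Design

/-! ### The drift of the allocation proportion -/

lemma eradeProb_mem_Icc {α r x : ℝ} (hα : α ∈ Set.Ico (0 : ℝ) 1) (hr : r ∈ Set.Ioo (0 : ℝ) 1) :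
    eradeProb α r x ∈ Set.Icc (0 : ℝ) 1 := by
  obtain ⟨h0, h1⟩ := hα
  obtain ⟨h2, h3⟩ := hr
  unfold eradeProb
  split_ifs <;> constructor <;> nlinarith

/-- The allocation rule pushes the number of assignments towards the target `n * ρ`, up to the error
of the estimated target `r`. -/
lemma eradeProb_drift_le {α r ρ N n : ℝ} (hα : α ∈ Set.Ico (0 : ℝ) 1) (hr : r ∈ Set.Ioo (0 : ℝ) 1)
    (hρ : ρ ∈ Set.Ioo (0 : ℝ) 1) (hn : 0 < n) (hN0 : 0 ≤ N) (hNn : N ≤ n) :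
    (N - n * ρ) * (eradeProb α r (N / n) - ρ) ≤ n * |r - ρ| := by
  have hp := eradeProb_mem_Icc (x := N / n) hα hr
  have habs := abs_nonneg (r - ρ)
  have hD1 : N - n * ρ ≤ n := by nlinarith [hρ.1]
  have hD2 : -(N - n * ρ) ≤ n := by nlinarith [hρ.2]
  rcases le_or_gt 0 (N - n * ρ) with hD | hD
  · rcases lt_or_ge (N / n) r with hlt | hge
    · -- here the drift has the wrong sign, but `N` lies between `n ρ` and `n r`
      rw [div_lt_iff₀ hn] at hlt
      have h1 : N - n * ρ ≤ n * |r - ρ| := by nlinarith [le_abs_self (r - ρ)]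
      nlinarith [hp.2, hρ.1]
    · have h1 : eradeProb α r (N / n) ≤ r := by
        unfold eradeProb
        split_ifs with h h'
        · nlinarith [hα.2, hr.1]
        · exact le_rfl
        · exact absurd (le_antisymm (not_lt.1 h) hge) h'
      calc (N - n * ρ) * (eradeProb α r (N / n) - ρ) ≤ (N - n * ρ) * |r - ρ| := by
            gcongr; linarith [le_abs_self (r - ρ)]
        _ ≤ _ := by gcongr
  · rcases lt_or_ge r (N / n) with hlt | hge
    · -- the symmetric case, with `N` between `n r` and `n ρ`
      rw [lt_div_iff₀ hn] at hlt
      have h1 : -(N - n * ρ) ≤ n * |r - ρ| := by nlinarith [neg_abs_le (r - ρ)]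
      nlinarith [hp.1, hρ.2]
    · have h1 : r ≤ eradeProb α r (N / n) := by
        unfold eradeProb
        split_ifs with h h'
        · exact absurd h (not_lt.2 hge)
        · exact le_rfl
        · nlinarith [hα.2, hr.2]
      calc (N - n * ρ) * (eradeProb α r (N / n) - ρ) =
            -(N - n * ρ) * (ρ - eradeProb α r (N / n)) := by ring
        _ ≤ -(N - n * ρ) * |r - ρ| := by
            gcongr
            · linarith
            · linarith [neg_abs_le (r - ρ)]
        _ ≤ _ := by gcongr

/-- A nonnegative sequence whose increments are bounded above by `o(n)` is `o(n²)`. -/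
lemma tendsto_div_sq_of_le_add {a c : ℕ → ℝ} {M₀ : ℕ} (ha : ∀ n, 0 ≤ a n)
    (hc : Tendsto c atTop (𝓝 0)) (h : ∀ n, M₀ ≤ n → a (n + 1) ≤ a n + n * c n) :
    Tendsto (fun n => a n / (n : ℝ) ^ 2) atTop (𝓝 0) := by
  rw [Metric.tendsto_atTop]
  intro ε hε
  obtain ⟨M, hM⟩ := eventually_atTop.1 ((hc.eventually_lt_const (half_pos hε)).and
    (eventually_ge_atTop M₀))
  have hbound : ∀ n, M ≤ n → a n ≤ a M + ε / 2 * (n : ℝ) ^ 2 := fun n hn => by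
    induction n, hn using Nat.le_induction with
    | base => nlinarith [sq_nonneg (M : ℝ)]
    | succ n hn ih =>
      have h1 := h n (hM n hn).2
      have h2 : (n : ℝ) * c n ≤ n * (ε / 2) := by
        have := (hM n hn).1.le
        gcongr
      push_cast
      nlinarith [Nat.cast_nonneg (α := ℝ) n]
  have hlim : Tendsto (fun n : ℕ => a M / (n : ℝ) ^ 2) atTop (𝓝 0) :=
    tendsto_const_nhds.div_atTop
      ((tendsto_pow_atTop two_ne_zero).comp tendsto_natCast_atTop_atTop)
  obtain ⟨K, hK⟩ := eventually_atTop.1 ((hlim.eventually_lt_const (half_pos hε)).and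
    ((eventually_ge_atTop M).and (eventually_gt_atTop 0)))
  refine ⟨K, fun n hn => ?_⟩
  obtain ⟨h1, h2, h3⟩ := hK n hn
  have hn0 : (0 : ℝ) < (n : ℝ) ^ 2 := by positivity
  rw [Real.dist_eq, sub_zero, abs_of_nonneg (div_nonneg (ha n) hn0.le)]
  calc a n / (n : ℝ) ^ 2 ≤ (a M + ε / 2 * (n : ℝ) ^ 2) / (n : ℝ) ^ 2 := by
        gcongr; exact hbound n h2
    _ = a M / (n : ℝ) ^ 2 + ε / 2 := by field_simp
    _ < ε := by linarith

/-- Up to the error of the estimated target `r`, the largest allocation probability is an affine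
function of the probability of treatment 1: the allocation rule takes only two values, one on either
side of the target. -/
lemma abs_max_eradeProb_sub_le {α r ρ x : ℝ} (hα : α ∈ Set.Ico (0 : ℝ) 1) (hx : x ≠ r) :
    |max (eradeProb α r x) (1 - eradeProb α r x) -
      (max (α * (1 - ρ)) (1 - α * (1 - ρ)) +
        (max (α * ρ) (1 - α * ρ) - max (α * (1 - ρ)) (1 - α * (1 - ρ))) *
          ((1 - α * (1 - ρ) - eradeProb α r x) / (1 - α)))| ≤
      (1 + |max (α * ρ) (1 - α * ρ) - max (α * (1 - ρ)) (1 - α * (1 - ρ))| / (1 - α)) *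
        |r - ρ| := by
  obtain ⟨h0, h1⟩ := hα
  have hα1 : 0 < 1 - α := sub_pos.2 h1
  have hlip : ∀ u v : ℝ, |max u (1 - u) - max v (1 - v)| ≤ |u - v| := fun u v => by
    refine (abs_max_sub_max_le_max _ _ _ _).trans (max_le le_rfl ?_)
    rw [show 1 - u - (1 - v) = -(u - v) by ring, abs_neg]
  have hmul : ∀ u v : ℝ, |α * u - α * v| ≤ |u - v| := fun u v => by
    rw [← mul_sub, abs_mul, abs_of_nonneg h0]
    nlinarith [abs_nonneg (u - v)]
  set a := max (α * ρ) (1 - α * ρ)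
  set b := max (α * (1 - ρ)) (1 - α * (1 - ρ))
  unfold eradeProb
  rcases lt_trichotomy r x with h | h | h
  · rw [if_pos h]
    have e1 : max (α * r) (1 - α * r) - (b + (a - b) * ((1 - α * (1 - ρ) - α * r) / (1 - α))) =
        (max (α * r) (1 - α * r) - a) + (a - b) / (1 - α) * (α * r - α * ρ) := by
      field_simp; ring
    rw [e1]
    refine (abs_add_le _ _).trans ?_
    rw [abs_mul, abs_div, abs_of_pos hα1, add_mul, one_mul]
    exact add_le_add ((hlip _ _).trans (hmul _ _))
      (mul_le_mul_of_nonneg_left (hmul _ _) (by positivity))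
  · exact absurd h.symm hx
  · rw [if_neg h.le.not_gt, if_neg hx]
    have e1 : max (1 - α * (1 - r)) (1 - (1 - α * (1 - r))) -
        (b + (a - b) * ((1 - α * (1 - ρ) - (1 - α * (1 - r))) / (1 - α))) =
        (max (α * (1 - r)) (1 - α * (1 - r)) - b) + (a - b) / (1 - α) * (α * r - α * ρ) := by
      rw [sub_sub_cancel, max_comm]
      field_simp; ring
    rw [e1]
    refine (abs_add_le _ _).trans ?_
    rw [abs_mul, abs_div, abs_of_pos hα1, add_mul, one_mul]
    refine add_le_add ((hlip _ _).trans ((hmul _ _).trans (le_of_eq ?_)))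
      (mul_le_mul_of_nonneg_left (hmul _ _) (by positivity))
    rw [show 1 - r - (1 - ρ) = -(r - ρ) by ring, abs_neg]

/-- Asymptotically the proportion of treatment 1 is below its target for a fraction `ρ` of the
patients and above it for the others, and the weighted mean of the corresponding largest allocation
probabilities has two regimes: if `2 α max ρ (1 - ρ) ≤ 1` the favoured treatment is always the more
probable one, and otherwise it is the treatment with the larger target that is. -/
lemma weighted_max_eq {α ρ : ℝ} (hα : α ∈ Set.Ico (0 : ℝ) 1) (hρ : ρ ∈ Set.Ioo (0 : ℝ) 1) :
    (2 * α * max ρ (1 - ρ) ≤ 1 →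
      ρ * max (α * (1 - ρ)) (1 - α * (1 - ρ)) + (1 - ρ) * max (α * ρ) (1 - α * ρ) =
        1 - 2 * α * ρ * (1 - ρ)) ∧
    (1 ≤ 2 * α * max ρ (1 - ρ) →
      ρ * max (α * (1 - ρ)) (1 - α * (1 - ρ)) + (1 - ρ) * max (α * ρ) (1 - α * ρ) =
        max ρ (1 - ρ)) := by
  obtain ⟨h0, h1⟩ := hα
  obtain ⟨h2, h3⟩ := hρ
  constructor
  · intro h
    have ha : α * ρ ≤ 1 - α * ρ := by nlinarith [le_max_left ρ (1 - ρ)]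
    have hb : α * (1 - ρ) ≤ 1 - α * (1 - ρ) := by nlinarith [le_max_right ρ (1 - ρ)]
    rw [max_eq_right ha, max_eq_right hb]
    ring
  · intro h
    rcases le_total ρ (1 - ρ) with hle | hle
    · rw [max_eq_right hle] at h ⊢
      rw [max_eq_left (by linarith : 1 - α * (1 - ρ) ≤ α * (1 - ρ)),
        max_eq_right (by nlinarith : α * ρ ≤ 1 - α * ρ)]
      ring
    · rw [max_eq_left hle] at h ⊢
      rw [max_eq_right (by nlinarith : α * (1 - ρ) ≤ 1 - α * (1 - ρ)),
        max_eq_left (by linarith : 1 - α * ρ ≤ α * ρ)]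
      ring

section Design

variable {Ω 𝒳 : Type*} [MeasurableSpace 𝒳] {X : ℕ → Ω → Fin 2} {Y : ℕ → Ω → 𝒳}
  [mΩ : MeasurableSpace Ω] {μ : Measure Ω}

/-! ### Convergence of the allocation proportion -/

lemma integrable_mul_allocProb (hX : ∀ m, Measurable (X m)) (hY : ∀ m, Measurable (Y m))
    {m : ℕ} (k : Fin 2) {f : Ω → ℝ} (hf : Measurable[history X Y m] f) {C : ℝ}
    (hC : ∀ ω, |f ω| ≤ C) : Integrable (fun ω => f ω * allocProb μ X Y m k ω) μ :=
  Integrable.bdd_mul integrable_condExp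
    (hf.mono (history_le hX hY m) le_rfl).aestronglyMeasurable (Eventually.of_forall hC)

variable [IsProbabilityMeasure μ]

lemma integrable_indicator_assigned (hX : ∀ m, Measurable (X m)) (m : ℕ) (k : Fin 2) :
    Integrable (({ω | X m ω = k} : Set Ω).indicator fun _ => (1 : ℝ)) μ :=
  (integrable_const _).indicator (hX m (measurableSet_singleton k))

lemma integrable_mul_assigned (hX : ∀ m, Measurable (X m)) (hY : ∀ m, Measurable (Y m))
    {m : ℕ} (k : Fin 2) {f : Ω → ℝ} (hf : Measurable[history X Y m] f) {C : ℝ}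
    (hC : ∀ ω, |f ω| ≤ C) :
    Integrable (fun ω => f ω * ({ω | X m ω = k} : Set Ω).indicator (fun _ => (1 : ℝ)) ω) μ :=
  Integrable.bdd_mul (integrable_indicator_assigned hX m k)
    (hf.mono (history_le hX hY m) le_rfl).aestronglyMeasurable (Eventually.of_forall hC)

lemma integral_mul_assigned (hX : ∀ m, Measurable (X m)) (hY : ∀ m, Measurable (Y m))
    {m : ℕ} (k : Fin 2) {f : Ω → ℝ} (hf : Measurable[history X Y m] f) {C : ℝ}
    (hC : ∀ ω, |f ω| ≤ C) :
    ∫ ω, f ω * ({ω | X m ω = k} : Set Ω).indicator (fun _ => (1 : ℝ)) ω ∂μ =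
      ∫ ω, f ω * allocProb μ X Y m k ω ∂μ := by
  rw [← integral_condExp (history_le hX hY m)]
  exact integral_congr_ae (condExp_mul_of_stronglyMeasurable_left hf.stronglyMeasurable
    (integrable_mul_assigned hX hY k hf hC) (integrable_indicator_assigned hX m k))

variable {d : Fin 2 → ℕ} {α : ℝ} {ρ₁ : ((k : Fin 2) → Param (d k)) → ℝ}
  {est : (k : Fin 2) → (n : ℕ) → (Fin n → 𝒳) → Param (d k)} {P : Fin 2 → Measure 𝒳} {m₀ : ℕ}

/-- The mean square deviation of the number of assignments from its target grows by at most
`1 + 2 n E|r_n - ρ|` at each step, where `r_n` is the estimated target. -/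
lemma IsERADE.integral_sq_succ_le (hα : α ∈ Set.Ico (0 : ℝ) 1)
    (hdesign : IsERADE μ α ρ₁ est P m₀ X Y) {ρ : ℝ} (hρ : ρ ∈ Set.Ioo (0 : ℝ) 1) {n : ℕ}
    (hn : m₀ ≤ n) (hn0 : 0 < n)
    (hr : ∀ᵐ ω ∂μ, ρ₁ (estimate est X Y n ω) ∈ Set.Ioo (0 : ℝ) 1)
    (hint : Integrable (fun ω => |ρ₁ (estimate est X Y n ω) - ρ|) μ) :
    ∫ ω, ((numAssigned X (n + 1) 0 ω : ℝ) - (n + 1 : ℕ) * ρ) ^ 2 ∂μ ≤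
      ∫ ω, ((numAssigned X n 0 ω : ℝ) - n * ρ) ^ 2 ∂μ +
        n * (2 * ∫ ω, |ρ₁ (estimate est X Y n ω) - ρ| ∂μ + 1 / n) := by
  have hX := hdesign.measurable_X
  have hY := hdesign.measurable_Y
  have hn0' : (0 : ℝ) < n := by exact_mod_cast hn0
  set D : Ω → ℝ := fun ω => (numAssigned X n 0 ω : ℝ) - n * ρ with hDdef
  have hD : Measurable[history X Y n] D := (measurable_numAssigned_cast n 0).sub_const _
  have hDb : ∀ ω, |D ω| ≤ n := fun ω => abs_numAssigned_sub_le hρ n 0 ω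
  have hDi : Integrable D μ := Integrable.of_bound
    (hD.mono (history_le hX hY n) le_rfl).aestronglyMeasurable n (Eventually.of_forall hDb)
  have hD2i : Integrable (fun ω => D ω ^ 2) μ := Integrable.of_bound
    ((hD.mono (history_le hX hY n) le_rfl).pow_const 2).aestronglyMeasurable ((n : ℝ) ^ 2)
    (Eventually.of_forall fun ω => by
      rw [Real.norm_eq_abs, abs_pow]; exact pow_le_pow_left₀ (abs_nonneg _) (hDb ω) 2)
  have hDX := integrable_mul_assigned (μ := μ) hX hY 0 hD hDb
  have hDp := integrable_mul_allocProb (μ := μ) hX hY 0 hD hDb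
  set W : Ω → ℝ := fun ω =>
    D ω * ({ω | X n ω = 0} : Set Ω).indicator (fun _ => (1 : ℝ)) ω - ρ * D ω with hW
  have hWi : Integrable W μ := hDX.sub (hDi.const_mul ρ)
  have hstep : ∀ ω, ((numAssigned X (n + 1) 0 ω : ℝ) - (n + 1 : ℕ) * ρ) ^ 2 ≤
      D ω ^ 2 + 2 * W ω + 1 := fun ω => by
    rw [numAssigned_succ, hW, hDdef]
    by_cases h : X n ω = 0
    · simp only [h, if_true, Set.indicator, Set.mem_ofPred_eq]
      push_cast
      nlinarith [hρ.1, hρ.2]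
    · simp only [h, if_false, Set.indicator, Set.mem_ofPred_eq]
      push_cast
      nlinarith [hρ.1, hρ.2]
  have hsum : Integrable (fun ω => D ω ^ 2 + 2 * W ω) μ := hD2i.add (hWi.const_mul 2)
  have hle1 : ∫ ω, ((numAssigned X (n + 1) 0 ω : ℝ) - (n + 1 : ℕ) * ρ) ^ 2 ∂μ ≤
      ∫ ω, (D ω ^ 2 + 2 * W ω + 1) ∂μ :=
    integral_mono_of_nonneg (Eventually.of_forall fun ω => sq_nonneg _)
      (hsum.add (integrable_const 1)) (Eventually.of_forall hstep)
  have hWp : ∫ ω, W ω ∂μ = ∫ ω, (D ω * allocProb μ X Y n 0 ω - ρ * D ω) ∂μ := by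
    rw [hW, integral_sub hDX (hDi.const_mul ρ), integral_sub hDp (hDi.const_mul ρ),
      integral_mul_assigned hX hY 0 hD hDb]
  rw [integral_add hsum (integrable_const 1), integral_add hD2i (hWi.const_mul 2),
    integral_const_mul, hWp] at hle1
  have hdrift : ∫ ω, (D ω * allocProb μ X Y n 0 ω - ρ * D ω) ∂μ ≤
      ∫ ω, n * |ρ₁ (estimate est X Y n ω) - ρ| ∂μ := by
    refine integral_mono_ae (hDp.sub (hDi.const_mul ρ)) (hint.const_mul _) ?_
    filter_upwards [hdesign.allocation n hn, hr] with ω h1 h2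
    have h := eradeProb_drift_le hα h2 hρ hn0' (Nat.cast_nonneg (numAssigned X n 0 ω))
      (by exact_mod_cast numAssigned_le n 0 ω)
    rw [← h1] at h
    simp only [hDdef] at *
    linarith
  rw [integral_const_mul] at hdrift
  simp only [integral_const, probReal_univ, smul_eq_mul, mul_one] at hle1
  rw [mul_add, mul_one_div_cancel hn0'.ne']
  linarith

lemma integral_abs_sub_tendsto_zero {r : ℕ → Ω → ℝ} {ρ : ℝ} (hρ : ρ ∈ Set.Ioo (0 : ℝ) 1)
    (hr : ∀ m, Measurable (r m)) (hmem : ∀ m, m₀ ≤ m → ∀ᵐ ω ∂μ, r m ω ∈ Set.Ioo (0 : ℝ) 1)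
    (hlim : ∀ᵐ ω ∂μ, Tendsto (fun m => r m ω) atTop (𝓝 ρ)) :
    Tendsto (fun m => ∫ ω, |r m ω - ρ| ∂μ) atTop (𝓝 0) := by
  have h := tendsto_integral_filter_of_dominated_convergence (μ := μ) (l := atTop)
    (F := fun m ω => |r m ω - ρ|) (f := fun _ => (0 : ℝ)) (fun _ => (1 : ℝ))
    (Eventually.of_forall fun m => ((hr m).sub_const ρ).abs.aestronglyMeasurable)
    (by
      filter_upwards [eventually_ge_atTop m₀] with m hm
      filter_upwards [hmem m hm] with ω hω
      rw [Real.norm_eq_abs, abs_abs, abs_le]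
      constructor <;> linarith [hω.1, hω.2, hρ.1, hρ.2])
    (integrable_const _)
    (by
      filter_upwards [hlim] with ω hω
      have := (hω.sub_const ρ).abs
      simpa using this)
  simpa using h

/-- The allocation proportion converges to the target in mean. -/
lemma IsERADE.tendsto_integral_proportion (hα : α ∈ Set.Ico (0 : ℝ) 1)
    (hdesign : IsERADE μ α ρ₁ est P m₀ X Y) {ρ : ℝ} (hρ : ρ ∈ Set.Ioo (0 : ℝ) 1)
    (hrm : ∀ m, Measurable fun ω => ρ₁ (estimate est X Y m ω))
    (hr : ∀ m, m₀ ≤ m → ∀ᵐ ω ∂μ, ρ₁ (estimate est X Y m ω) ∈ Set.Ioo (0 : ℝ) 1)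
    (hlim : ∀ᵐ ω ∂μ, Tendsto (fun m => ρ₁ (estimate est X Y m ω)) atTop (𝓝 ρ)) :
    Tendsto (fun n : ℕ => (n : ℝ)⁻¹ * ∫ ω, (numAssigned X n 0 ω : ℝ) ∂μ) atTop (𝓝 ρ) := by
  have hX := hdesign.measurable_X
  have hY := hdesign.measurable_Y
  have hint : ∀ m, m₀ ≤ m → Integrable (fun ω => |ρ₁ (estimate est X Y m ω) - ρ|) μ := fun m hm =>
    Integrable.of_bound ((hrm m).sub_const ρ).abs.aestronglyMeasurable 1 (by
      filter_upwards [hr m hm] with ω hω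
      rw [Real.norm_eq_abs, abs_abs, abs_le]
      constructor <;> linarith [hω.1, hω.2, hρ.1, hρ.2])
  set a : ℕ → ℝ := fun n => ∫ ω, ((numAssigned X n 0 ω : ℝ) - n * ρ) ^ 2 ∂μ with ha
  have hc : Tendsto (fun n : ℕ => 2 * ∫ ω, |ρ₁ (estimate est X Y n ω) - ρ| ∂μ + 1 / (n : ℝ)) atTop
      (𝓝 0) := by
    have := ((integral_abs_sub_tendsto_zero hρ hrm hr hlim).const_mul 2).add
      tendsto_one_div_atTop_nhds_zero_nat
    simpa using this
  have hsq := tendsto_div_sq_of_le_add (a := a) (M₀ := m₀ + 1)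
    (fun n => integral_nonneg fun ω => sq_nonneg _) hc
    (fun n hn => hdesign.integral_sq_succ_le hα hρ (by omega) (by omega) (hr n (by omega))
      (hint n (by omega)))
  have hroot : Tendsto (fun n => Real.sqrt (a n / (n : ℝ) ^ 2)) atTop (𝓝 0) := by
    have := hsq.sqrt
    simpa using this
  rw [tendsto_iff_dist_tendsto_zero]
  refine squeeze_zero' (Eventually.of_forall fun n => dist_nonneg) ?_ hroot
  filter_upwards [eventually_gt_atTop 0] with n hn
  have hn' : (0 : ℝ) < n := by exact_mod_cast hn
  have hNm : Measurable fun ω => (numAssigned X n 0 ω : ℝ) :=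
    (measurable_numAssigned_cast (Y := Y) n 0).mono (history_le hX hY n) le_rfl
  have hNi : Integrable (fun ω => (numAssigned X n 0 ω : ℝ)) μ :=
    Integrable.of_bound hNm.aestronglyMeasurable n (Eventually.of_forall fun ω => by
      rw [Real.norm_eq_abs, abs_of_nonneg (Nat.cast_nonneg _)]
      exact_mod_cast numAssigned_le n 0 ω)
  have hDL : MemLp (fun ω => (numAssigned X n 0 ω : ℝ) - n * ρ) 2 μ :=
    MemLp.of_bound (hNm.sub_const _).aestronglyMeasurable n
      (Eventually.of_forall fun ω => abs_numAssigned_sub_le hρ n 0 ω)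
  -- `(E D)² ≤ E D²`, as the variance is nonnegative
  have hjensen : (∫ ω, ((numAssigned X n 0 ω : ℝ) - n * ρ) ∂μ) ^ 2 ≤ a n := by
    have h1 := variance_eq_sub hDL
    have h2 := variance_nonneg (fun ω => (numAssigned X n 0 ω : ℝ) - n * ρ) μ
    rw [h1] at h2
    simpa using h2
  have hmean : ∫ ω, ((numAssigned X n 0 ω : ℝ) - n * ρ) ∂μ =
      n * ((n : ℝ)⁻¹ * ∫ ω, (numAssigned X n 0 ω : ℝ) ∂μ - ρ) := by
    rw [integral_sub hNi (integrable_const _)]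
    simp only [integral_const, probReal_univ, one_smul]
    field_simp
  rw [hmean, mul_pow] at hjensen
  rw [Real.dist_eq, ← Real.sqrt_sq_eq_abs]
  refine Real.sqrt_le_sqrt ?_
  rw [le_div_iff₀ (by positivity)]
  linarith

/-! ### The expected proportion of correct guesses -/

/-- An optimal guess is correct with the largest of the allocation probabilities. -/
lemma IsOptimalGuess.integral_correct (hX : ∀ m, Measurable (X m)) (hY : ∀ m, Measurable (Y m))
    {G : ℕ → Ω → Fin 2} (hG : IsOptimalGuess μ X Y G) (m : ℕ) :
    ∫ ω, (if G m ω = X m ω then (1 : ℝ) else 0) ∂μ =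
      ∫ ω, max (allocProb μ X Y m 0 ω) (1 - allocProb μ X Y m 0 ω) ∂μ := by
  obtain ⟨hGm, hmax⟩ := hG m
  set g : Fin 2 → Ω → ℝ := fun k => ({ω | G m ω = k} : Set Ω).indicator fun _ => (1 : ℝ)
  have hg : ∀ k, Measurable[history X Y m] (g k) := fun k =>
    measurable_const.indicator (hGm (measurableSet_singleton k))
  have hgb : ∀ k ω, |g k ω| ≤ 1 := fun k ω => by
    simp only [g, Set.indicator]; split_ifs <;> simp
  have hsplit : ∀ ω, (if G m ω = X m ω then (1 : ℝ) else 0) =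
      g 0 ω * ({ω | X m ω = 0} : Set Ω).indicator (fun _ => (1 : ℝ)) ω +
      g 1 ω * ({ω | X m ω = 1} : Set Ω).indicator (fun _ => (1 : ℝ)) ω := fun ω => by
    rcases Fin.exists_fin_two.1 ⟨X m ω, rfl⟩ with h | h <;>
      rcases Fin.exists_fin_two.1 ⟨G m ω, rfl⟩ with h' | h' <;> simp [g, Set.indicator, h, h']
  simp only [hsplit]
  rw [integral_add (integrable_mul_assigned hX hY 0 (hg 0) (hgb 0))
      (integrable_mul_assigned hX hY 1 (hg 1) (hgb 1)),
    integral_mul_assigned hX hY 0 (hg 0) (hgb 0), integral_mul_assigned hX hY 1 (hg 1) (hgb 1),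
    ← integral_add (integrable_mul_allocProb hX hY 0 (hg 0) (hgb 0))
      (integrable_mul_allocProb hX hY 1 (hg 1) (hgb 1))]
  refine integral_congr_ae ?_
  filter_upwards [hmax, allocProb_one (μ := μ) hX hY m] with ω h1 h2
  have h10 := h1 0
  have h11 := h1 1
  rcases Fin.exists_fin_two.1 ⟨G m ω, rfl⟩ with h | h
  · rw [h, h2] at h11
    simp [g, h, max_eq_left h11]
  · rw [h, h2] at h10
    simp [g, h, max_eq_right h10, h2]

lemma selectionBias_eq (hX : ∀ m, Measurable (X m)) (hY : ∀ m, Measurable (Y m))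
    {G : ℕ → Ω → Fin 2} (hG : IsOptimalGuess μ X Y G) (n : ℕ) :
    selectionBias μ X G n = (n : ℝ)⁻¹ * ∑ m ∈ Finset.range n,
      ∫ ω, max (allocProb μ X Y m 0 ω) (1 - allocProb μ X Y m 0 ω) ∂μ := by
  unfold selectionBias
  rw [integral_const_mul, one_div, integral_finsetSum]
  · simp only [hG.integral_correct hX hY]
  · intro m _
    have hGm : Measurable (G m) := (hG m).1.mono (history_le hX hY m) le_rfl
    have h : MeasurableSet {ω | G m ω = X m ω} := measurableSet_eq_fun hGm (hX m)
    refine ((integrable_const (μ := μ) (1 : ℝ)).indicator h).congr (Eventually.of_forall fun ω => ?_)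
    simp [Set.indicator]

lemma sum_integral_allocProb (hX : ∀ m, Measurable (X m)) (hY : ∀ m, Measurable (Y m)) (n : ℕ) :
    ∑ m ∈ Finset.range n, ∫ ω, allocProb μ X Y m 0 ω ∂μ =
      ∫ ω, (numAssigned X n 0 ω : ℝ) ∂μ := by
  have h1 : ∀ m, ∫ ω, allocProb μ X Y m 0 ω ∂μ =
      ∫ ω, ({ω | X m ω = 0} : Set Ω).indicator (fun _ => (1 : ℝ)) ω ∂μ := fun m =>
    integral_condExp (history_le hX hY m)
  simp only [h1]
  rw [← integral_finsetSum _ fun m _ => integrable_indicator_assigned hX m 0]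
  refine integral_congr_ae (Eventually.of_forall fun ω => ?_)
  simp only
  induction n with
  | zero => simp [numAssigned_zero]
  | succ n ih =>
    rw [Finset.sum_range_succ, ih, numAssigned_succ]
    by_cases h : X n ω = 0 <;> simp [h]

end Design

theorem mainTheorem2
    {Ω 𝒳 : Type*} [MeasurableSpace Ω] [MeasurableSpace 𝒳]
    (μ : Measure Ω) [IsProbabilityMeasure μ]
    (d : Fin 2 → ℕ)
    (Θ : (k : Fin 2) → Set (Param (d k)))
    (θ : (k : Fin 2) → Param (d k)) (hθ : ∀ k, θ k ∈ Θ k)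
    (P : Fin 2 → Measure 𝒳)
    (est : (k : Fin 2) → (n : ℕ) → (Fin n → 𝒳) → Param (d k))
    (hest_meas : ∀ k n, Measurable (est k n))
    (hmodel : ∀ k, IsResponseModel (Θ k) (θ k) (P k) (est k))
    (ρ₁ : ((k : Fin 2) → Param (d k)) → ℝ)
    (hρ_meas : Measurable ρ₁)
    (hρ_cont : ContinuousOn ρ₁ (Set.univ.pi Θ))
    (hρ_mem : ∀ t ∈ Set.univ.pi Θ, ρ₁ t ∈ Set.Ioo (0 : ℝ) 1)
    (α : ℝ) (hα : α ∈ Set.Ico (0 : ℝ) 1)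
    (m₀ : ℕ) (hm₀ : 1 ≤ m₀)
    (X : ℕ → Ω → Fin 2) (Y : ℕ → Ω → 𝒳)
    (hdesign : IsERADE μ α ρ₁ est P m₀ X Y)
    (hest_mem : ∀ m, m₀ ≤ m → ∀ᵐ ω ∂μ, estimate est X Y m ω ∈ Set.univ.pi Θ)
    (hrat : ∀ m, m₀ ≤ m → ∀ v : ℚ, 0 ≤ v → v ≤ 1 →
      μ {ω | ρ₁ (estimate est X Y m ω) = (v : ℝ)} = 0)
    (G : ℕ → Ω → Fin 2) (hG : IsOptimalGuess μ X Y G) :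
    (2 * α * max (ρ₁ θ) (1 - ρ₁ θ) ≤ 1 →
      Tendsto (selectionBias μ X G) atTop (𝓝 (1 - 2 * α * ρ₁ θ * (1 - ρ₁ θ)))) ∧
    (1 ≤ 2 * α * max (ρ₁ θ) (1 - ρ₁ θ) →
      Tendsto (selectionBias μ X G) atTop (𝓝 (max (ρ₁ θ) (1 - ρ₁ θ)))) := by
  have hX := hdesign.measurable_X
  have hY := hdesign.measurable_Y
  have hρ : ρ₁ θ ∈ Set.Ioo (0 : ℝ) 1 := hρ_mem θ fun k _ => hθ k
  have hrm : ∀ m, Measurable fun ω => ρ₁ (estimate est X Y m ω) := fun m =>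
    hρ_meas.comp (measurable_estimate hX hY hest_meas m)
  have hr : ∀ m, m₀ ≤ m → ∀ᵐ ω ∂μ, ρ₁ (estimate est X Y m ω) ∈ Set.Ioo (0 : ℝ) 1 := fun m hm =>
    (hest_mem m hm).mono fun ω hω => hρ_mem _ hω
  have hlim := hdesign.ae_tendsto_target hα hθ hmodel hρ_cont hρ_mem hest_mem
  have hprop := hdesign.tendsto_integral_proportion hα hρ hrm hr hlim
  have herr := integral_abs_sub_tendsto_zero hρ hrm hr hlim
  set ρ := ρ₁ θ
  set a := max (α * ρ) (1 - α * ρ) with ha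
  set b := max (α * (1 - ρ)) (1 - α * (1 - ρ)) with hb
  have hα1 : 0 < 1 - α := sub_pos.2 hα.2
  set q : ℕ → ℝ := fun m => ∫ ω, allocProb μ X Y m 0 ω ∂μ
  set M : ℕ → ℝ := fun m => ∫ ω, max (allocProb μ X Y m 0 ω) (1 - allocProb μ X Y m 0 ω) ∂μ
  -- the affine function of the allocation probability that approximates the largest one
  set u : ℝ := b + (a - b) * ((1 - α * (1 - ρ)) / (1 - α)) with hu
  set v : ℝ := (a - b) / (1 - α) with hv
  have hM : Tendsto (fun m => M m - (u - v * q m)) atTop (𝓝 0) := by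
    have hC := herr.const_mul (1 + |a - b| / (1 - α))
    rw [mul_zero] at hC
    refine squeeze_zero_norm' ?_ hC
    filter_upwards [eventually_ge_atTop m₀] with m hm
    have hpi : Integrable (allocProb μ X Y m 0) μ := integrable_condExp
    have hMi : Integrable (fun ω => max (allocProb μ X Y m 0 ω) (1 - allocProb μ X Y m 0 ω)) μ :=
      hpi.sup ((integrable_const 1).sub hpi)
    have hli : Integrable (fun ω => u - v * allocProb μ X Y m 0 ω) μ :=
      (integrable_const u).sub (hpi.const_mul v)
    have hei : Integrable (fun ω => |ρ₁ (estimate est X Y m ω) - ρ|) μ :=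
      Integrable.of_bound ((hrm m).sub_const ρ).abs.aestronglyMeasurable 1 (by
        filter_upwards [hr m hm] with ω hω
        rw [Real.norm_eq_abs, abs_abs, abs_le]
        constructor <;> linarith [hω.1, hω.2, hρ.1, hρ.2])
    have hrew : M m - (u - v * q m) = ∫ ω, (max (allocProb μ X Y m 0 ω)
        (1 - allocProb μ X Y m 0 ω) - (u - v * allocProb μ X Y m 0 ω)) ∂μ := by
      rw [integral_sub hMi hli, integral_sub (integrable_const u) (hpi.const_mul v),
        integral_const_mul]
      simp [M, q]
    rw [hrew, ← integral_const_mul]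
    refine norm_integral_le_of_norm_le (hei.const_mul _) ?_
    -- the current proportion is one of the rationals `j / m` in `[0, 1]`, so it misses the target
    have hne : ∀ᵐ ω ∂μ, (numAssigned X m 0 ω : ℝ) / m ≠ ρ₁ (estimate est X Y m ω) := by
      have hall : ∀ᵐ ω ∂μ, ∀ j : ℕ, j ≤ m →
          ρ₁ (estimate est X Y m ω) ≠ (((j : ℚ) / m : ℚ) : ℝ) := by
        refine ae_all_iff.2 fun j => ae_all_iff.2 fun hj => ?_
        have h := hrat m hm ((j : ℚ) / m) (by positivity)
          (div_le_one_of_le₀ (by exact_mod_cast hj) (by positivity))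
        exact compl_mem_ae_iff.2 h
      filter_upwards [hall] with ω hω
      have h := hω _ (numAssigned_le (X := X) m 0 ω)
      push_cast at h
      exact h.symm
    filter_upwards [hdesign.allocation m hm, hne] with ω h1 h2
    have h := abs_max_eradeProb_sub_le (ρ := ρ) hα h2
    rw [← h1, ← ha, ← hb] at h
    rw [Real.norm_eq_abs]
    convert h using 2
    rw [hu, hv]
    field_simp
    ring
  have hces := hM.cesaro
  have hSB : Tendsto (selectionBias μ X G) atTop (𝓝 (ρ * b + (1 - ρ) * a)) := by
    have h := hces.add ((hprop.const_mul v).const_sub u)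
    have hval : 0 + (u - v * ρ) = ρ * b + (1 - ρ) * a := by
      rw [hu, hv]
      field_simp
      ring
    rw [hval] at h
    refine h.congr' ?_
    filter_upwards [eventually_gt_atTop 0] with n hn
    have hn' : (n : ℝ) ≠ 0 := by exact_mod_cast hn.ne'
    rw [selectionBias_eq hX hY hG, ← sum_integral_allocProb hX hY, Finset.sum_sub_distrib,
      Finset.sum_sub_distrib, ← Finset.mul_sum]
    simp only [Finset.sum_const, Finset.card_range, nsmul_eq_mul]
    field_simp
    ring
  obtain ⟨h1, h2⟩ := weighted_max_eq hα hρ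
  exact ⟨fun h => h1 h ▸ hSB, fun h => h2 h ▸ hSB⟩
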